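/- **Setting.** For $k\in\mathbb N=\{1,2,\dots\}$ let $A_{1,k}=[0,1/k]$ and $A_{j,k}=((j-1)/k,\,j/k]$ ($2\le j\le k$), let $c_{j,k}=(j-1/2)/k$, and let $A_{j,k}^-$ and $A_{j,k}^+$ be the left and the right half of $A_{j,k}$. For weights $\mathbf w_k=(w_{1,k},\dots,w_{k,k})$ in the simplex, the polygon $p_{\mathbf w_k}$ is $$p_{\mathbf w_k}(x)=w_{1,k}k\mathbf 1_{A_{1,k}^-}(x)+\sum_{j=1}^{k-1}\big[k(c_{j+1,k}-x)w_{j,k}+k(x-c_{j,k})w_{j+1,k}\big]k\,\mathbf 1_{A_{j,k}^+\cup A_{j+1,k}^-}(x)+w_{k,k}k\mathbf 1_{A_{k,k}^+}(x),\qquad x\in[0,1].$$ Let $\rho$ be a probability mass function on $\mathbb N$ and $\alpha$ a finite measure on $[0,1]$. The polygonally smoothed prior $\Pi$ is the law of the random density $f_P=p_{\mathbf w_k}$, where $k\sim\rho$ and, given $k$, $\mathbf w_k=(P(A_{1,k}),\dots,P(A_{k,k}))$ with $P$ a Dirichlet process with base measure $\alpha$, i.e. $\mathbf w_k\sim\mathrm{Dir}_k(\alpha(A_{1,k}),\dots,\alpha(A_{k,k}))$.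 For data $X^{(n)}=(X_1,\dots,X_n)$ let $\Pi(\cdot\mid X^{(n)})\propto\prod_{i=1}^n f_P(X_i)\,\Pi(\mathrm dP)$ be the posterior and $\hat f_n(x)=\int f_P(x)\,\Pi(\mathrm dP\mid X^{(n)})$ the Bayes estimator. Write $\|\cdot\|_1$ for the $L^1$-norm with respect to Lebesgue measure $\lambda$ on $[0,1]$, and $\mathbb E_0^n$ for the expectation when $X_1,\dots,X_n$ are i.i.d. with density $f_0$. A function on $[0,1]$ is Hölder $\beta$-smooth if, with $m$ the largest integer $\geq 0$ that is strictly smaller than $\beta$, it is $m$ times differentiable and its $m$-th derivative is Hölder continuous on $[0,1]$ with exponent $\beta-m$. **Theorem.** Let $\Pi$ be a polygonally smoothed prior such that, for some constants $B_1,B_2,\beta_1,\beta_2>0$, $B_1e^{-\beta_1k\log k}\le\rho(k)\le B_2e^{-\beta_2k\log k}$ for all $k\in\mathbb N$, and such that $\alpha$ has a continuous and positive Lebesgue density on $[0,1]$. Let $\beta\in(0,2]$ and let $f_0$ be a Hölder $\beta$-smooth probability density on $[0,1]$ with $1/f_0\in L^1(\lambda)$. If $\beta>1$, suppose in addition that there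 are $a_0,b_0\in\mathbb R$ and $p,q\in[\beta-1,\infty)$ with - (BC1) $f_0'(x)=a_0x^p+o(x^p)$ as $x\downarrow0$, - (BC2) $f_0'(x)=b_0(1-x)^q+o((1-x)^q)$ as $x\uparrow1$. Then, for every sufficiently large constant $M>0$, $$\mathbb E_0^n\Big[\Pi\big(P:\ \|f_P-f_0\|_1>M\,n^{-\beta/(2\beta+1)}(\log n)^{\beta/(2\beta+1)}\,\big|\,X^{(n)}\big)\Big]\to0\qquad(n\to\infty),$$ and $$\mathbb E_0^n\big[\|\hat f_n-f_0\|_1^2\big]=O\big(n^{-2\beta/(2\beta+1)}(\log n)^{2\beta/(2\beta+1)}\big).$$ The prior does not depend on $\beta$; the constants ($M$ and the one in $O$) may depend on $f_0$, $\beta$ and the prior. -/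

import Mathlib

open MeasureTheory ProbabilityTheory Set Filter Topology Asymptotics

noncomputable section

namespace RandomPolygon

/-- The Lebesgue measure on `[0, 1]`. -/
def lam : Measure ℝ := volume.restrict (Icc 0 1)

/-- The bins of the partition of `[0, 1]` into `k` intervals of length `1 / k`, numbered from `0`:
`bin k 0 = [0, 1/k]` and `bin k j = (j/k, (j+1)/k]` for `1 ≤ j ≤ k - 1`. -/
def bin (k j : ℕ) : Set ℝ :=
  if j = 0 then Icc 0 (1 / (k : ℝ)) else Ioc ((j : ℝ) / k) (((j : ℝ) + 1) / k)

/-- The midpoint of the bin number `j` (numbered from `0`). -/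
def mid (k j : ℕ) : ℝ := ((j : ℝ) + 1 / 2) / k

/-- The left half of a bin. -/
def leftHalf (k j : ℕ) : Set ℝ := bin k j ∩ Iic (mid k j)

/-- The right half of a bin. -/
def rightHalf (k j : ℕ) : Set ℝ := bin k j ∩ Ioi (mid k j)

/-- The polygon with weights `w`: it takes the value `k * w j` at the midpoint of the bin `j`, it is
linear between consecutive midpoints, and constant on the first and the last half-bin.
Bins and weights are numbered from `0`. -/
def polygon (k : ℕ+) (w : Fin k → ℝ) (x : ℝ) : ℝ :=
  (leftHalf k 0).indicator (fun _ => w ⟨0, k.pos⟩ * k) x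
  + ∑ j : Fin ((k : ℕ) - 1),
      (rightHalf k j ∪ leftHalf k (j + 1)).indicator
        (fun y => ((k : ℝ) * (mid k (j + 1) - y) * w ⟨j, by omega⟩
          + (k : ℝ) * (y - mid k j) * w ⟨j + 1, by omega⟩) * k) x
  + (rightHalf k ((k : ℕ) - 1)).indicator
      (fun _ => w ⟨(k : ℕ) - 1, Nat.sub_lt k.pos Nat.one_pos⟩ * k) x

/-- The Dirichlet distribution with positive parameters `a 0, …, a (k-1)`: the law of
`(G 0 / S, …, G (k-1) / S)`, where the `G j` are independent Gamma variables with shapes `a j` and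
rate `1`, and `S` is their sum. -/
def dirichlet {k : ℕ} (a : Fin k → ℝ) : Measure (Fin k → ℝ) :=
  (Measure.pi fun j => gammaMeasure (a j) 1).map fun g j => g j / ∑ i, g i

/-- The parameter space: a number `k ≥ 1` of bins together with a vector of `k` weights. -/
abbrev Param : Type := Σ k : ℕ+, (Fin k → ℝ)

/-- The density that belongs to a parameter. -/
def Param.density (θ : Param) : ℝ → ℝ := polygon θ.1 θ.2

/-- The polygonally smoothed prior: `k` is drawn from `ρ`, and, given `k`, the weights are
distributed as `(P(A_1), …, P(A_k))`, where `A_1, …, A_k` are the `k` bins and `P` is a Dirichlet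
process with base measure `α`, that is, as `Dir_k(α(A_1), …, α(A_k))`. -/
def polygonPrior (ρ : PMF ℕ+) (α : Measure ℝ) : Measure Param :=
  Measure.sum fun k : ℕ+ =>
    ρ k • (dirichlet fun j : Fin k => (α (bin k j)).toReal).map (fun w => (⟨k, w⟩ : Param))

/-- The likelihood of a parameter, given the data. -/
def likelihood {n : ℕ} (X : Fin n → ℝ) (θ : Param) : ENNReal :=
  ∏ i, ENNReal.ofReal (θ.density (X i))

/-- The posterior distribution, by Bayes' formula. -/
def postDist (π : Measure Param) {n : ℕ} (X : Fin n → ℝ) : Measure Param :=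
  (∫⁻ θ, likelihood X θ ∂π)⁻¹ • π.withDensity (likelihood X)

/-- The Bayes estimator (posterior expected density, predictive density). -/
def bayesEstimator (π : Measure Param) {n : ℕ} (X : Fin n → ℝ) (x : ℝ) : ℝ :=
  ∫ θ, θ.density x ∂(postDist π X)

/-- The `L¹`-distance on `[0, 1]`. -/
def distL1 (f g : ℝ → ℝ) : ENNReal := eLpNorm (fun x => f x - g x) 1 lam

/-- The joint law of `n` independent observations with density `f₀` on `[0, 1]`. -/
def sampleLaw (f₀ : ℝ → ℝ) (n : ℕ) : Measure (Fin n → ℝ) :=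
  Measure.pi fun _ => lam.withDensity fun x => ENNReal.ofReal (f₀ x)

/-- `f` is a probability density on `[0, 1]`. -/
def IsDensity (f : ℝ → ℝ) : Prop :=
  (∀ x ∈ Icc (0 : ℝ) 1, 0 ≤ f x) ∧ ∫⁻ x, ENNReal.ofReal (f x) ∂lam = 1

/-- `f` is Hölder `β`-smooth on `[0, 1]` (for `β > 0`): with `m` the largest natural number
`< β`, the derivative of order `m` exists and is Hölder continuous with exponent `β - m`. -/
def HolderSmooth (β : ℝ) (f : ℝ → ℝ) : Prop :=
  ContDiffOn ℝ ((⌈β⌉₊ - 1 : ℕ) : WithTop ℕ∞) f (Icc 0 1) ∧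
  ∃ L : ℝ, 0 < L ∧ ∀ x ∈ Icc (0 : ℝ) 1, ∀ y ∈ Icc (0 : ℝ) 1,
    |iteratedDerivWithin (⌈β⌉₊ - 1) f (Icc 0 1) x - iteratedDerivWithin (⌈β⌉₊ - 1) f (Icc 0 1) y|
      ≤ L * |x - y| ^ (β - ((⌈β⌉₊ - 1 : ℕ) : ℝ))

/-- The boundary condition at `0`: `f'(x) = a₀ x^p + o(x^p)` as `x ↓ 0`, with `β - 1 ≤ p`. -/
def BC1 (β : ℝ) (f : ℝ → ℝ) : Prop :=
  ∃ a₀ p : ℝ, β - 1 ≤ p ∧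
    (fun x => derivWithin f (Icc 0 1) x - a₀ * x ^ p) =o[𝓝[>] 0] fun x => x ^ p

/-- The boundary condition at `1`: `f'(x) = b₀ (1-x)^q + o((1-x)^q)` as `x ↑ 1`,
with `β - 1 ≤ q`. -/
def BC2 (β : ℝ) (f : ℝ → ℝ) : Prop :=
  ∃ b₀ q : ℝ, β - 1 ≤ q ∧
    (fun x => derivWithin f (Icc 0 1) x - b₀ * (1 - x) ^ q) =o[𝓝[<] 1] fun x => (1 - x) ^ q

/-- The rate `n^{-β/(2β+1)} (log n)^{β/(2β+1)}`. -/
def rate (β : ℝ) (n : ℕ) : ℝ :=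
  (n : ℝ) ^ (-(β / (2 * β + 1))) * Real.log n ^ (β / (2 * β + 1))

end RandomPolygon

end

/-! The proof is a posterior contraction argument, carried out with `n ε² = m log n`, where `m = (n
/ log n)^{1/(2β+1)}` is the ideal number of bins and `ε = m^{-β}` is the rate.

Approximation. On an inner cell a polygon is a convex combination of the values at two neighbouring
midpoints, so affine functions are reproduced and `k` bins approximate `f₀` uniformly to order
`k^{-β}`. On the two outer half-bins the polygon is flat; for `β > 1` this is harmless because the
boundary conditions force `f₀'(0) = f₀'(1) = 0` (`exists_polygon_approx`).

Prior mass. The Dirichlet weights are normalized Gamma variables. If each Gamma variable lies in a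
short interval slightly above `f₀(mid)/k`, the unnormalized polygon lies above `f₀`, so after
division by its mass `S` it is still at least `f₀ / S`. The chi-square divergence is then controlled
by `∫ 1/f₀`, with no lower bound on `f₀`. For `k` of order `m` the prior gives a chi-square ball of
squared radius of order `ε²` a mass of at least `exp(-const · n ε²)`
(`exists_dirichlet_chiSqBall_ge`, `polygonPrior_chiSqBall_ge`).

Evidence. The expected inverse likelihood ratio is the `n`-th power of one plus the chi-square
divergence, so Markov's inequality bounds the evidence from below with high probability
(`sampleLaw_evidence_lt_le`).

Far sets. Polygons with more than `K ~ L m` bins have negligible prior mass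
(`polygonPrior_fst_gt_le`). The others are covered by `exp(const · m log n)` boxes of weights, each
dominated by one upper polygon. A posterior mass is at most its own square root, so the expected
mass of a box is governed by the `n`-th power of the Hellinger affinity of its upper polygon with
`f₀` (`lintegral_postDist_le`, `boxUpper_affinity_le`). At distance `M ε` with `M` large this beats
the number of boxes.

The expected posterior mass of the far set is thus of order `exp(-n ε²)`, hence of order `ε²`
(`exists_expected_posterior_le`). This gives contraction, and the risk of the Bayes estimator
follows by convexity of the norm. -/

namespace RandomPolygon

open scoped ENNReal

/-! ### Measurability on the parameter space -/

theorem measurableSet_param_iff {S : Set Param} :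
    MeasurableSet S ↔ ∀ k : ℕ+, MeasurableSet {w : Fin k → ℝ | (⟨k, w⟩ : Param) ∈ S} := by
  rw [Sigma.instMeasurableSpace, MeasurableSpace.measurableSet_iInf]
  rfl

theorem measurableEmbedding_param (k : ℕ+) :
    MeasurableEmbedding (fun w : Fin k → ℝ => (⟨k, w⟩ : Param)) where
  injective := fun _ _ h => sigma_mk_injective h
  measurable := fun _ hS => measurableSet_param_iff.1 hS k
  measurableSet_image' := by
    intro s hs
    rw [measurableSet_param_iff]
    intro l
    by_cases h : l = k
    · subst h
      convert hs using 1
      ext w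
      simp
    · convert MeasurableSet.empty
      ext w
      simp only [mem_ofPred_eq, mem_image, mem_empty_iff_false, iff_false, not_exists, not_and]
      intro v _ hv
      exact h (congrArg Sigma.fst hv).symm

/-- Measurability in the parameter alone is fibrewise by definition. With a second variable it also
needs that there are countably many fibres and that each of them embeds measurably. -/
theorem measurable_prod_param {β γ : Type*} [MeasurableSpace β] [MeasurableSpace γ]
    {f : Param × β → γ}
    (hf : ∀ k : ℕ+, Measurable fun z : (Fin k → ℝ) × β => f (⟨k, z.1⟩, z.2)) : Measurable f := by
  intro s hs
  have he : ∀ k : ℕ+, MeasurableEmbedding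
      (Prod.map (fun w : Fin k → ℝ => (⟨k, w⟩ : Param)) (id : β → β)) := fun k =>
    (measurableEmbedding_param k).prodMap MeasurableEmbedding.id
  have : f ⁻¹' s = ⋃ k : ℕ+, (Prod.map (fun w : Fin k → ℝ => (⟨k, w⟩ : Param)) (id : β → β)) ''
      ((fun z : (Fin k → ℝ) × β => f (⟨k, z.1⟩, z.2)) ⁻¹' s) := by
    ext ⟨⟨k, w⟩, b⟩
    simp only [mem_preimage, mem_iUnion, mem_image]
    constructor
    · intro h
      exact ⟨k, (w, b), h, rfl⟩
    · rintro ⟨l, ⟨v, b'⟩, h, h'⟩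
      rw [← h']
      exact h
  rw [this]
  exact MeasurableSet.iUnion fun k => (he k).measurableSet_image' (hf k hs)

theorem measurableSet_bin (k j : ℕ) : MeasurableSet (bin k j) := by
  unfold bin
  split_ifs
  exacts [measurableSet_Icc, measurableSet_Ioc]

theorem measurable_polygon (k : ℕ+) :
    Measurable fun z : (Fin k → ℝ) × ℝ => polygon k z.1 z.2 := by
  have hL : ∀ j, MeasurableSet (leftHalf k j) := fun j =>
    (measurableSet_bin k j).inter measurableSet_Iic
  have hR : ∀ j, MeasurableSet (rightHalf k j) := fun j =>
    (measurableSet_bin k j).inter measurableSet_Ioi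
  have key : ∀ (s : Set ℝ) (g : (Fin k → ℝ) → ℝ → ℝ), MeasurableSet s →
      (Measurable fun z : (Fin k → ℝ) × ℝ => g z.1 z.2) →
      Measurable fun z : (Fin k → ℝ) × ℝ => s.indicator (g z.1) z.2 := by
    intro s g hs hg
    have : (fun z : (Fin k → ℝ) × ℝ => s.indicator (g z.1) z.2)
        = (Prod.snd ⁻¹' s).indicator fun z => g z.1 z.2 := by
      ext z
      by_cases h : z.2 ∈ s
      · rw [indicator_of_mem h, indicator_of_mem (show z ∈ Prod.snd ⁻¹' s from h)]
      · rw [indicator_of_notMem h, indicator_of_notMem (show z ∉ Prod.snd ⁻¹' s from h)]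
    rw [this]
    exact hg.indicator (measurable_snd hs)
  unfold polygon
  refine ((key _ (fun w _ => w ⟨0, k.pos⟩ * k) (hL 0) (by fun_prop)).add ?_).add
    (key _ (fun w _ => w ⟨(k : ℕ) - 1, Nat.sub_lt k.pos Nat.one_pos⟩ * k) (hR _) (by fun_prop))
  refine Finset.measurable_sum _ fun j _ => ?_
  exact key _ (fun w y => ((k : ℝ) * (mid k (j + 1) - y) * w ⟨j, by omega⟩
          + (k : ℝ) * (y - mid k j) * w ⟨j + 1, by omega⟩) * k) ((hR _).union (hL _)) (by fun_prop)

theorem measurable_density : Measurable fun z : Param × ℝ => z.1.density z.2 :=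
  measurable_prod_param measurable_polygon

theorem measurable_density_comp {β : Type*} [MeasurableSpace β] {f : β → Param} {g : β → ℝ}
    (hf : Measurable f) (hg : Measurable g) : Measurable fun b => (f b).density (g b) := by
  have h := measurable_density.comp (hf.prodMk hg)
  exact h

theorem measurable_density_left (θ : Param) : Measurable θ.density :=
  measurable_density_comp (f := fun _ : ℝ => θ) (g := id) measurable_const measurable_id

/-! ### The general posterior bound -/

/-- The likelihood ratio with respect to `f₀`. -/
noncomputable def likRatio (f₀ : ℝ → ℝ) {n : ℕ} (θ : Param) (X : Fin n → ℝ) : ℝ≥0∞ :=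
  ∏ i, ENNReal.ofReal (θ.density (X i)) / ENNReal.ofReal (f₀ (X i))

variable {f₀ : ℝ → ℝ} {n : ℕ}

theorem isProbabilityMeasure_withDensity (hd : IsDensity f₀) :
    IsProbabilityMeasure (lam.withDensity fun x => ENNReal.ofReal (f₀ x)) :=
  ⟨by rw [withDensity_apply _ MeasurableSet.univ, Measure.restrict_univ, hd.2]⟩

theorem isProbabilityMeasure_sampleLaw (hd : IsDensity f₀) (n : ℕ) :
    IsProbabilityMeasure (sampleLaw f₀ n) := by
  have := isProbabilityMeasure_withDensity hd
  unfold sampleLaw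
  infer_instance

theorem lintegral_sampleLaw_prod (hf : Measurable f₀) (hd : IsDensity f₀) (n : ℕ) {h : ℝ → ℝ≥0∞}
    (hh : Measurable h) :
    ∫⁻ X, ∏ i, h (X i) ∂(sampleLaw f₀ n)
      = (∫⁻ x, ENNReal.ofReal (f₀ x) * h x ∂lam) ^ n := by
  have := isProbabilityMeasure_withDensity hd
  unfold sampleLaw
  have hind := iIndepFun_pi (μ := fun _ : Fin n => lam.withDensity fun x => ENNReal.ofReal (f₀ x))
    (X := fun _ => h) fun _ => hh.aemeasurable
  rw [lintegral_prod_eq_prod_lintegral_of_indepFun _ _ hind (fun i => by fun_prop)]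
  have : ∀ i : Fin n, ∫⁻ X : Fin n → ℝ, h (X i)
      ∂(Measure.pi fun _ : Fin n => lam.withDensity fun x => ENNReal.ofReal (f₀ x))
      = ∫⁻ x, ENNReal.ofReal (f₀ x) * h x ∂lam := by
    intro i
    have := (measurePreserving_eval
      (fun _ : Fin n => lam.withDensity fun x => ENNReal.ofReal (f₀ x)) i).lintegral_comp hh
    simp only [Function.eval] at this
    rw [this, lintegral_withDensity_eq_lintegral_mul _ (by fun_prop) hh]
    rfl
  simp [this]

theorem ae_sampleLaw_pos (hf : Measurable f₀) (hd : IsDensity f₀) (n : ℕ) :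
    ∀ᵐ X ∂(sampleLaw f₀ n), ∀ i, 0 < f₀ (X i) := by
  have := isProbabilityMeasure_withDensity hd
  rw [ae_all_iff]
  intro i
  have h : ∀ᵐ x ∂(lam.withDensity fun x => ENNReal.ofReal (f₀ x)), 0 < f₀ x := by
    rw [ae_withDensity_iff (by fun_prop)]
    exact ae_of_all _ fun x hx => by simpa using hx
  exact (measurePreserving_eval
    (fun _ : Fin n => lam.withDensity fun x => ENNReal.ofReal (f₀ x)) i).quasiMeasurePreserving.ae h

theorem measurable_likRatio (hf : Measurable f₀) :
    Measurable fun z : (Fin n → ℝ) × Param => likRatio f₀ z.2 z.1 := by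
  unfold likRatio
  refine Finset.measurable_prod _ fun i _ => ?_
  have := measurable_density_comp (f := fun z : (Fin n → ℝ) × Param => z.2) (g := fun z => z.1 i)
    (by fun_prop) (by fun_prop)
  fun_prop

/-- AM-GM for `z = c r`. It turns an upper bound on an average of inverse likelihood ratios into a
lower bound on the evidence, with a free constant `c`. -/
theorem two_le_mul_add_inv {c r : ℝ≥0∞} (hc : c ≠ 0) (hc' : c ≠ ∞) :
    2 ≤ c * r + c⁻¹ * r⁻¹ := by
  rcases eq_or_ne r 0 with rfl | h0
  · simp [hc', ENNReal.mul_top]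
  rcases eq_or_ne r ∞ with rfl | h1
  · simp [hc, ENNReal.mul_top]
  lift c to NNReal using hc'
  lift r to NNReal using h1
  simp only [ne_eq, ENNReal.coe_eq_zero] at hc h0
  rw [← ENNReal.coe_inv hc, ← ENNReal.coe_inv h0]
  norm_cast
  rw [← mul_inv]
  have h : 0 < c * r := by positivity
  generalize c * r = z at h
  have h' : (0 : ℝ) < z := h
  rw [← NNReal.coe_le_coe]
  push_cast
  rw [← sub_nonneg, show (z : ℝ) + (z : ℝ)⁻¹ - 2 = ((z : ℝ) - 1) ^ 2 / z by field_simp; ring]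
  positivity

theorem likRatio_inv {θ : Param} {X : Fin n → ℝ} (hX : ∀ i, 0 < f₀ (X i)) :
    (likRatio f₀ θ X)⁻¹
      = ∏ i, (ENNReal.ofReal (θ.density (X i)) / ENNReal.ofReal (f₀ (X i)))⁻¹ := by
  unfold likRatio
  refine ENNReal.prod_inv_distrib fun i _ j _ _ => Or.inr ?_
  exact ENNReal.div_ne_top ENNReal.ofReal_ne_top (by simpa using hX j)

theorem likelihood_eq {θ : Param} {X : Fin n → ℝ} (hX : ∀ i, 0 < f₀ (X i)) :
    likelihood X θ = (∏ i, ENNReal.ofReal (f₀ (X i))) * likRatio f₀ θ X := by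
  unfold likelihood likRatio
  rw [← Finset.prod_mul_distrib]
  refine Finset.prod_congr rfl fun i _ => ?_
  rw [ENNReal.mul_div_cancel (by simpa using hX i) ENNReal.ofReal_ne_top]

theorem measurable_likRatio_right (hf : Measurable f₀) (X : Fin n → ℝ) :
    Measurable fun θ => likRatio f₀ θ X := by
  have h := (measurable_likRatio (n := n) hf).comp (measurable_prodMk_left (x := X))
  exact h

/-- The factor `∏ f₀(X i)` is finite and nonzero, so it cancels from Bayes' formula. -/
theorem postDist_apply_eq (hf : Measurable f₀) (π : Measure Param) {X : Fin n → ℝ}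
    (hX : ∀ i, 0 < f₀ (X i)) {S : Set Param} (hS : MeasurableSet S) :
    postDist π X S = (∫⁻ θ, likRatio f₀ θ X ∂π)⁻¹ * ∫⁻ θ in S, likRatio f₀ θ X ∂π := by
  have hQ : (∏ i, ENNReal.ofReal (f₀ (X i))) ≠ 0 :=
    Finset.prod_ne_zero_iff.2 fun i _ => by simpa using hX i
  have hQ' : (∏ i, ENNReal.ofReal (f₀ (X i))) ≠ ∞ :=
    ENNReal.prod_ne_top fun i _ => ENNReal.ofReal_ne_top
  unfold postDist
  rw [Measure.smul_apply, withDensity_apply _ hS, smul_eq_mul]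
  simp_rw [likelihood_eq hX]
  rw [lintegral_const_mul _ (measurable_likRatio_right hf X),
    lintegral_const_mul _ (measurable_likRatio_right hf X),
    ENNReal.mul_inv (Or.inl hQ) (Or.inl hQ'), mul_mul_mul_comm, ENNReal.inv_mul_cancel hQ hQ',
    one_mul]

theorem postDist_univ_le_one (π : Measure Param) (X : Fin n → ℝ) : postDist π X univ ≤ 1 := by
  unfold postDist
  rw [Measure.smul_apply, withDensity_apply _ MeasurableSet.univ, smul_eq_mul,
    Measure.restrict_univ]
  exact ENNReal.inv_mul_le_one _

theorem measurable_comp_likRatio (hf : Measurable f₀) {g : ℝ≥0∞ → ℝ≥0∞} (hg : Measurable g) :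
    Measurable fun z : (Fin n → ℝ) × Param => g (likRatio f₀ z.2 z.1) := by
  have h := hg.comp (measurable_likRatio (n := n) hf)
  exact h

theorem measurable_lintegral_likRatio (hf : Measurable f₀) {g : ℝ≥0∞ → ℝ≥0∞}
    (hg : Measurable g) (π : Measure Param) [SFinite π] :
    Measurable fun X : Fin n → ℝ => ∫⁻ θ, g (likRatio f₀ θ X) ∂π := by
  have h := (measurable_comp_likRatio (n := n) hf hg).lintegral_prod_right' (ν := π)
  exact h

theorem lintegral_likRatio_swap (hf : Measurable f₀) {g : ℝ≥0∞ → ℝ≥0∞} (hg : Measurable g)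
    (μ : Measure (Fin n → ℝ)) [SFinite μ] (π : Measure Param) [SFinite π] :
    ∫⁻ X, ∫⁻ θ, g (likRatio f₀ θ X) ∂π ∂μ = ∫⁻ θ, ∫⁻ X, g (likRatio f₀ θ X) ∂μ ∂π := by
  have h := (measurable_comp_likRatio (n := n) hf hg).aemeasurable (μ := μ.prod π)
  have h2 := lintegral_lintegral_swap (f := fun X θ => g (likRatio f₀ θ X)) h
  exact h2

/-- By AM-GM, a small evidence forces the average of `1 / likRatio` over `B` to be at least `c
π(B)`. The mean of that average is at most `s ^ n π(B)`, by Tonelli and independence, and Markov's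
inequality concludes. -/
theorem sampleLaw_evidence_lt_le (hf : Measurable f₀) (hd : IsDensity f₀) (π : Measure Param)
    [IsFiniteMeasure π] {B : Set Param} (hB : MeasurableSet B) {s c : ℝ≥0∞}
    (hBs : ∀ θ ∈ B, ∫⁻ x, ENNReal.ofReal (f₀ x)
      * (ENNReal.ofReal (θ.density x) / ENNReal.ofReal (f₀ x))⁻¹ ∂lam ≤ s)
    (hB0 : π B ≠ 0) (hc : c ≠ 0) (hc' : c ≠ ∞) (n : ℕ) :
    sampleLaw f₀ n {X | c * ∫⁻ θ, likRatio f₀ θ X ∂π < π B} ≤ c⁻¹ * s ^ n := by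
  have := isProbabilityMeasure_sampleLaw hd n
  have hBt : π B ≠ ∞ := measure_ne_top π B
  have hmeas : Measurable fun X : Fin n → ℝ => ∫⁻ θ in B, (likRatio f₀ θ X)⁻¹ ∂π :=
    measurable_lintegral_likRatio hf measurable_inv _
  have hsub : {X : Fin n → ℝ | c * ∫⁻ θ, likRatio f₀ θ X ∂π < π B}
      ⊆ {X | c * π B ≤ ∫⁻ θ in B, (likRatio f₀ θ X)⁻¹ ∂π} := by
    intro X hX
    simp only [mem_ofPred_eq] at hX ⊢
    have h1 : 2 * π B ≤ c * ∫⁻ θ in B, likRatio f₀ θ X ∂π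
        + c⁻¹ * ∫⁻ θ in B, (likRatio f₀ θ X)⁻¹ ∂π := by
      rw [← lintegral_const_mul _ (measurable_likRatio_right hf X),
        ← lintegral_const_mul (f := fun θ => (likRatio f₀ θ X)⁻¹) _
          (measurable_likRatio_right hf X).inv,
        ← lintegral_add_left ((measurable_likRatio_right hf X).const_mul c)]
      calc 2 * π B = ∫⁻ _ in B, 2 ∂π := by rw [setLIntegral_const]
        _ ≤ _ := lintegral_mono fun θ => two_le_mul_add_inv hc hc'
    have h2 : c * ∫⁻ θ in B, likRatio f₀ θ X ∂π ≤ π B :=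
      (mul_le_mul_right (setLIntegral_le_lintegral _ _) c).trans hX.le
    have h3 : π B + π B ≤ π B + c⁻¹ * ∫⁻ θ in B, (likRatio f₀ θ X)⁻¹ ∂π := by
      rw [← two_mul]
      exact h1.trans (add_le_add_left h2 _)
    have h4 := (ENNReal.add_le_add_iff_left hBt).1 h3
    calc c * π B ≤ c * (c⁻¹ * ∫⁻ θ in B, (likRatio f₀ θ X)⁻¹ ∂π) := mul_le_mul_right h4 c
      _ = _ := by rw [← mul_assoc, ENNReal.mul_inv_cancel hc hc', one_mul]
  have hint : ∫⁻ X, ∫⁻ θ in B, (likRatio f₀ θ X)⁻¹ ∂π ∂(sampleLaw f₀ n) ≤ s ^ n * π B := by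
    rw [lintegral_likRatio_swap hf (measurable_inv), ← setLIntegral_const]
    refine setLIntegral_mono' hB fun θ hθ => ?_
    have hm : Measurable fun x =>
        (ENNReal.ofReal (θ.density x) / ENNReal.ofReal (f₀ x))⁻¹ := by
      have := measurable_density_left θ
      fun_prop
    have h1 : ∫⁻ X, (likRatio f₀ θ X)⁻¹ ∂(sampleLaw f₀ n) = ∫⁻ X, ∏ i,
        (ENNReal.ofReal (θ.density (X i)) / ENNReal.ofReal (f₀ (X i)))⁻¹ ∂(sampleLaw f₀ n) := by
      refine lintegral_congr_ae ?_
      filter_upwards [ae_sampleLaw_pos hf hd n] with X hX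
      exact likRatio_inv hX
    rw [h1, lintegral_sampleLaw_prod hf hd n hm]
    gcongr
    exact hBs θ hθ
  refine (measure_mono hsub).trans ((meas_ge_le_lintegral_div hmeas.aemeasurable
    (mul_ne_zero hc hB0) (ENNReal.mul_ne_top hc' hBt)).trans ?_)
  refine (ENNReal.div_le_div_right hint _).trans (le_of_eq ?_)
  rw [ENNReal.div_eq_inv_mul, ENNReal.mul_inv (Or.inl hc) (Or.inl hc'), mul_comm (s ^ n),
    mul_assoc, ← mul_assoc (π B)⁻¹, ENNReal.inv_mul_cancel hB0 hBt, one_mul]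

/-- Equality can fail: the mass that the polygon puts where `f₀` vanishes is lost. -/
theorem lintegral_likRatio_le_one (hf : Measurable f₀) (hd : IsDensity f₀) {θ : Param}
    (hθ : ∫⁻ x, ENNReal.ofReal (θ.density x) ∂lam ≤ 1) (n : ℕ) :
    ∫⁻ X, likRatio f₀ θ X ∂(sampleLaw f₀ n) ≤ 1 := by
  have hm : Measurable fun x => ENNReal.ofReal (θ.density x) / ENNReal.ofReal (f₀ x) := by
    have := measurable_density_left θ
    fun_prop
  have h := lintegral_sampleLaw_prod hf hd n hm
  unfold likRatio
  rw [h]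
  refine pow_le_one₀ zero_le ((lintegral_mono fun x => ?_).trans hθ)
  exact ENNReal.mul_div_le

/-- The square root of a likelihood ratio has the Hellinger affinity as its expectation. -/
theorem lintegral_sampleLaw_prod_sqrt_le (hf : Measurable f₀) (hd : IsDensity f₀) {u : ℝ → ℝ}
    (hu : Measurable u) (n : ℕ) :
    ∫⁻ X, ∏ i, (ENNReal.ofReal (u (X i)) / ENNReal.ofReal (f₀ (X i))) ^ (1 / 2 : ℝ)
        ∂(sampleLaw f₀ n)
      ≤ (∫⁻ x, ENNReal.ofReal √(u x * f₀ x) ∂lam) ^ n := by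
  have hm : Measurable fun x => (ENNReal.ofReal (u x) / ENNReal.ofReal (f₀ x)) ^ (1 / 2 : ℝ) := by
    fun_prop
  have h := lintegral_sampleLaw_prod hf hd n hm
  rw [h]
  gcongr with x
  rcases le_or_gt (f₀ x) 0 with h0 | h0
  · simp [ENNReal.ofReal_of_nonpos h0]
  rcases le_or_gt (u x) 0 with h1 | h1
  · simp [ENNReal.ofReal_of_nonpos h1]
  rw [← ENNReal.ofReal_div_of_pos h0, ENNReal.ofReal_rpow_of_nonneg (by positivity) (by norm_num),
    ← ENNReal.ofReal_mul h0.le, ← Real.sqrt_eq_rpow]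
  apply le_of_eq
  congr 1
  rw [Real.sqrt_div h1.le, Real.sqrt_mul h1.le]
  have := Real.mul_self_sqrt h0.le
  have h2 : 0 < √(f₀ x) := Real.sqrt_pos.2 h0
  field_simp
  nlinarith

theorem le_rpow_half_of_le_one {a : ℝ≥0∞} (ha : a ≤ 1) : a ≤ a ^ (1 / 2 : ℝ) := by
  conv_lhs => rw [← ENNReal.rpow_one a]
  exact ENNReal.rpow_le_rpow_of_exponent_ge ha (by norm_num)

theorem postDist_le (hf : Measurable f₀) (π : Measure Param) {X : Fin n → ℝ}
    (hX : ∀ i, 0 < f₀ (X i)) {b : ℝ≥0∞} (hb : b⁻¹ ≤ ∫⁻ θ, likRatio f₀ θ X ∂π) {S : Set Param}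
    (hS : MeasurableSet S) :
    postDist π X S ≤ b * ∫⁻ θ in S, likRatio f₀ θ X ∂π := by
  rw [postDist_apply_eq hf π hX hS]
  gcongr
  rw [← inv_inv b]
  exact ENNReal.inv_le_inv.2 hb

/-- The posterior mass is at most one, hence at most its square root, and the domination by a single
`u` removes the integral over `θ`. What remains is the square root of one likelihood ratio, whose
mean is bounded by a power of an affinity, so no tests are needed. -/
theorem postDist_le_sqrt (hf : Measurable f₀) (π : Measure Param) [IsProbabilityMeasure π]
    {X : Fin n → ℝ} (hXI : ∀ i, X i ∈ Icc (0 : ℝ) 1)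
    (hX : ∀ i, 0 < f₀ (X i)) {b : ℝ≥0∞} (hb : b⁻¹ ≤ ∫⁻ θ, likRatio f₀ θ X ∂π) {S : Set Param}
    (hS : MeasurableSet S) {u : ℝ → ℝ} (hu : ∀ θ ∈ S, ∀ x ∈ Icc (0 : ℝ) 1, θ.density x ≤ u x) :
    postDist π X S ≤ b ^ (1 / 2 : ℝ)
      * ∏ i, (ENNReal.ofReal (u (X i)) / ENNReal.ofReal (f₀ (X i))) ^ (1 / 2 : ℝ) := by
  have h1 : postDist π X S ≤ 1 := (measure_mono (subset_univ S)).trans (postDist_univ_le_one π X)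
  refine (le_rpow_half_of_le_one h1).trans ?_
  rw [ENNReal.prod_rpow_of_nonneg (by norm_num), ← ENNReal.mul_rpow_of_nonneg _ _ (by norm_num)]
  gcongr
  refine (postDist_le hf π hX hb hS).trans ?_
  gcongr
  calc ∫⁻ θ in S, likRatio f₀ θ X ∂π
      ≤ ∫⁻ _ in S, ∏ i, (ENNReal.ofReal (u (X i)) / ENNReal.ofReal (f₀ (X i))) ∂π := by
        refine setLIntegral_mono' hS fun θ hθ => ?_
        unfold likRatio
        gcongr with i
        exact hu θ hθ _ (hXI i)
    _ = (∏ i, (ENNReal.ofReal (u (X i)) / ENNReal.ofReal (f₀ (X i)))) * π S := by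
        rw [setLIntegral_const]
    _ ≤ _ := by
        conv_rhs => rw [← mul_one (∏ i, _)]
        gcongr
        exact prob_le_one

theorem ae_sampleLaw_mem_Icc (hd : IsDensity f₀) (n : ℕ) :
    ∀ᵐ X ∂(sampleLaw f₀ n), ∀ i, X i ∈ Icc (0 : ℝ) 1 := by
  have := isProbabilityMeasure_withDensity hd
  rw [ae_all_iff]
  intro i
  have h : ∀ᵐ x ∂(lam.withDensity fun x => ENNReal.ofReal (f₀ x)), x ∈ Icc (0 : ℝ) 1 :=
    (withDensity_absolutelyContinuous _ _).ae_le (ae_restrict_mem measurableSet_Icc)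
  exact (measurePreserving_eval
    (fun _ : Fin n => lam.withDensity fun x => ENNReal.ofReal (f₀ x)) i).quasiMeasurePreserving.ae h

/-- The posterior mass of a set that is covered by a set `V` of small prior mass and by sets `U i`
whose densities are dominated by functions `u i` of small affinity with `f₀`. -/
theorem lintegral_postDist_le (hf : Measurable f₀) (hd : IsDensity f₀) (π : Measure Param)
    [IsProbabilityMeasure π] {B V S : Set Param} (hB : MeasurableSet B) (hV : MeasurableSet V)
    {s c : ℝ≥0∞}
    (hBs : ∀ θ ∈ B, ∫⁻ x, ENNReal.ofReal (f₀ x)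
      * (ENNReal.ofReal (θ.density x) / ENNReal.ofReal (f₀ x))⁻¹ ∂lam ≤ s)
    (hB0 : π B ≠ 0) (hc : c ≠ 0) (hc' : c ≠ ∞)
    (hπ : ∀ᵐ θ ∂π, ∫⁻ x, ENNReal.ofReal (θ.density x) ∂lam ≤ 1)
    {ι : Type*} (I : Finset ι) {U : ι → Set Param} (hU : ∀ i ∈ I, MeasurableSet (U i))
    {u : ι → ℝ → ℝ} (hum : ∀ i ∈ I, Measurable (u i))
    (hu : ∀ i ∈ I, ∀ θ ∈ U i, ∀ x ∈ Icc (0 : ℝ) 1, θ.density x ≤ u i x)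
    (hS : S ⊆ V ∪ ⋃ i ∈ I, U i) (n : ℕ) :
    ∫⁻ X, postDist π X S ∂(sampleLaw f₀ n)
      ≤ c⁻¹ * s ^ n + c / π B * π V
        + ∑ i ∈ I, (c / π B) ^ (1 / 2 : ℝ) * (∫⁻ x, ENNReal.ofReal √(u i x * f₀ x) ∂lam) ^ n := by
  have := isProbabilityMeasure_sampleLaw hd n
  -- The bad event of small evidence. On it the posterior mass is bounded by one; off it, division
  -- by the evidence costs at most the factor `b` below.
  set E : Set (Fin n → ℝ) := {X | c * ∫⁻ θ, likRatio f₀ θ X ∂π < π B} with hE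
  have hEm : MeasurableSet E :=
    measurableSet_lt ((measurable_lintegral_likRatio hf measurable_id π).const_mul c)
      measurable_const
  set b := c / π B with hb
  have hpt : ∀ᵐ X ∂(sampleLaw f₀ n), postDist π X S ≤ E.indicator 1 X
      + b * ∫⁻ θ in V, likRatio f₀ θ X ∂π
      + ∑ i ∈ I, b ^ (1 / 2 : ℝ)
        * ∏ j, (ENNReal.ofReal (u i (X j)) / ENNReal.ofReal (f₀ (X j))) ^ (1 / 2 : ℝ) := by
    filter_upwards [ae_sampleLaw_pos hf hd n, ae_sampleLaw_mem_Icc hd n] with X hX hXI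
    by_cases hXE : X ∈ E
    · rw [indicator_of_mem hXE, Pi.one_apply, add_assoc]
      exact ((measure_mono (subset_univ S)).trans (postDist_univ_le_one π X)).trans le_self_add
    · rw [indicator_of_notMem hXE, zero_add]
      have hev : b⁻¹ ≤ ∫⁻ θ, likRatio f₀ θ X ∂π := by
        rw [hb, ENNReal.inv_div (Or.inl (measure_ne_top π B)) (Or.inl hB0)]
        rw [hE, mem_ofPred_eq, not_lt] at hXE
        exact ENNReal.div_le_of_le_mul' hXE
      calc postDist π X S ≤ postDist π X V + ∑ i ∈ I, postDist π X (U i) :=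
            (measure_mono hS).trans ((measure_union_le _ _).trans
              (add_le_add le_rfl (measure_biUnion_finset_le I U)))
        _ ≤ _ := add_le_add (postDist_le hf π hX hev hV)
              (Finset.sum_le_sum fun i hi => postDist_le_sqrt hf π hXI hX hev (hU i hi) (hu i hi))
  refine (lintegral_mono_ae hpt).trans ?_
  have hm1 : Measurable fun X : Fin n → ℝ => b * ∫⁻ θ in V, likRatio f₀ θ X ∂π :=
    (measurable_lintegral_likRatio hf measurable_id _).const_mul b
  have hm2 : ∀ i ∈ I, Measurable fun X : Fin n → ℝ =>
      ∏ j, (ENNReal.ofReal (u i (X j)) / ENNReal.ofReal (f₀ (X j))) ^ (1 / 2 : ℝ) := by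
    intro i hi
    have := hum i hi
    fun_prop
  have hm0 : Measurable fun X : Fin n → ℝ => E.indicator (1 : (Fin n → ℝ) → ℝ≥0∞) X :=
    measurable_one.indicator hEm
  have hm01 : Measurable fun X : Fin n → ℝ => E.indicator (1 : (Fin n → ℝ) → ℝ≥0∞) X
      + b * ∫⁻ θ in V, likRatio f₀ θ X ∂π := hm0.add hm1
  rw [lintegral_add_left hm01,
    lintegral_add_left hm0, lintegral_indicator_one hEm,
    lintegral_finsetSum' _ fun i hi => ((hm2 i hi).const_mul _).aemeasurable,
    lintegral_const_mul (f := fun X => ∫⁻ θ in V, likRatio f₀ θ X ∂π) b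
      (measurable_lintegral_likRatio hf measurable_id _)]
  refine add_le_add (add_le_add (sampleLaw_evidence_lt_le hf hd π hB hBs hB0 hc hc' n) ?_)
    (Finset.sum_le_sum fun i hi => ?_)
  · gcongr
    have h := lintegral_likRatio_swap hf measurable_id (sampleLaw f₀ n) (π.restrict V)
    simp only [id] at h ⊢
    rw [h, ← setLIntegral_one]
    refine lintegral_mono_ae ((ae_restrict_of_ae hπ).mono fun θ hθ => ?_)
    exact lintegral_likRatio_le_one hf hd hθ n
  · rw [lintegral_const_mul _ (hm2 i hi)]
    gcongr
    exact lintegral_sampleLaw_prod_sqrt_le hf hd (hum i hi) n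

/-! ### The shape of a polygon -/

theorem leftHalf_zero (k : ℕ+) : leftHalf k 0 = Icc 0 (mid k 0) := by
  have hk : (0 : ℝ) < k := by exact_mod_cast k.pos
  ext x
  simp only [leftHalf, bin, mid, if_true, mem_inter_iff, mem_Icc, mem_Iic]
  have : ((0 : ℕ) + 1 / 2 : ℝ) / k ≤ 1 / k := by
    push_cast; gcongr; norm_num
  constructor
  · rintro ⟨⟨h1, -⟩, h2⟩; exact ⟨h1, h2⟩
  · rintro ⟨h1, h2⟩; exact ⟨⟨h1, h2.trans this⟩, h2⟩

theorem mid_lt_mid {k : ℕ+} {i j : ℕ} : mid k i < mid k j ↔ i < j := by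
  have hk : (0 : ℝ) < k := by exact_mod_cast k.pos
  unfold mid
  rw [div_lt_div_iff_of_pos_right hk, add_lt_add_iff_right, Nat.cast_lt]

theorem rightHalf_eq (k : ℕ+) (j : ℕ) :
    rightHalf k j = Ioc (mid k j) (((j : ℝ) + 1) / k) := by
  have hk : (0 : ℝ) < k := by exact_mod_cast k.pos
  have h1 : (j : ℝ) / k < mid k j := by unfold mid; gcongr; linarith
  have h0 : (0 : ℝ) ≤ (j : ℝ) / k := by positivity
  ext x
  unfold rightHalf bin
  split_ifs with hj
  · subst hj
    simp only [mem_inter_iff, mem_Icc, mem_Ioi, mem_Ioc]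
    simp only [Nat.cast_zero, zero_add] at *
    constructor
    · rintro ⟨⟨-, h2⟩, h3⟩; exact ⟨h3, h2⟩
    · rintro ⟨h2, h3⟩; exact ⟨⟨by linarith, h3⟩, h2⟩
  · simp only [mem_inter_iff, mem_Ioc, mem_Ioi]
    constructor
    · rintro ⟨⟨-, h2⟩, h3⟩; exact ⟨h3, h2⟩
    · rintro ⟨h2, h3⟩; exact ⟨⟨by linarith, h3⟩, h2⟩

theorem leftHalf_succ (k : ℕ+) (j : ℕ) :
    leftHalf k (j + 1) = Ioc (((j : ℝ) + 1) / k) (mid k (j + 1)) := by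
  have hk : (0 : ℝ) < k := by exact_mod_cast k.pos
  have h1 : mid k (j + 1) ≤ ((j : ℝ) + 1 + 1) / k := by
    unfold mid; push_cast; gcongr; norm_num
  ext x
  simp only [leftHalf, bin, Nat.succ_ne_zero, if_false, mem_inter_iff, mem_Ioc, mem_Iic,
    Nat.cast_add, Nat.cast_one]
  constructor
  · rintro ⟨⟨h2, -⟩, h3⟩; exact ⟨h2, h3⟩
  · rintro ⟨h2, h3⟩; exact ⟨⟨h2, by linarith⟩, h3⟩

theorem rightHalf_union_leftHalf (k : ℕ+) (j : ℕ) :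
    rightHalf k j ∪ leftHalf k (j + 1) = Ioc (mid k j) (mid k (j + 1)) := by
  have hk : (0 : ℝ) < k := by exact_mod_cast k.pos
  rw [rightHalf_eq, leftHalf_succ, Ioc_union_Ioc_eq_Ioc]
  · unfold mid; gcongr; norm_num
  · unfold mid; push_cast; rw [div_le_div_iff_of_pos_right hk]; linarith

theorem rightHalf_last (k : ℕ+) : rightHalf k ((k : ℕ) - 1) = Ioc (mid k ((k : ℕ) - 1)) 1 := by
  have hk : (0 : ℝ) < k := by exact_mod_cast k.pos
  rw [rightHalf_eq, Nat.cast_sub k.pos, Nat.cast_one, sub_add_cancel, div_self hk.ne']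

theorem polygon_eq (k : ℕ+) (w : Fin k → ℝ) (x : ℝ) :
    polygon k w x = (Icc 0 (mid k 0)).indicator (fun _ => w ⟨0, k.pos⟩ * k) x
      + ∑ j : Fin ((k : ℕ) - 1), (Ioc (mid k j) (mid k (j + 1))).indicator
        (fun y => ((k : ℝ) * (mid k (j + 1) - y) * w ⟨j, by omega⟩
          + (k : ℝ) * (y - mid k j) * w ⟨j + 1, by omega⟩) * k) x
      + (Ioc (mid k ((k : ℕ) - 1)) 1).indicator
        (fun _ => w ⟨(k : ℕ) - 1, Nat.sub_lt k.pos Nat.one_pos⟩ * k) x := by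
  unfold polygon
  simp only [leftHalf_zero, rightHalf_union_leftHalf, rightHalf_last]

/-- On `[0, 1]`, a polygon interpolates between the values at the two closest midpoints, and is
constant on the first and on the last half-bin. -/
theorem exists_polygon_eq (k : ℕ+) {x : ℝ} (hx : x ∈ Icc (0 : ℝ) 1) :
    ∃ i j : Fin k, ∃ a b : ℝ, 0 ≤ a ∧ 0 ≤ b ∧ a + b = 1 ∧
      |mid k i - x| ≤ 1 / k ∧ |mid k j - x| ≤ 1 / k ∧
      (∀ w : Fin k → ℝ, polygon k w x = k * (a * w i + b * w j)) ∧
      (a * mid k i + b * mid k j = x ∨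
        (i = j ∧ x ≤ mid k i ∧ mid k i ≤ 1 / k) ∨
        (i = j ∧ mid k i ≤ x ∧ 1 - mid k i ≤ 1 / k)) := by
  have hk : (0 : ℝ) < k := by exact_mod_cast k.pos
  have hkk : ((k : ℕ) : ℝ) * (1 / k) = 1 := by field_simp
  have hm0 : mid k 0 = 1 / 2 * (1 / k) := by unfold mid; push_cast; ring
  have hm1 : mid k ((k : ℕ) - 1) = 1 - 1 / 2 * (1 / k) := by
    unfold mid; rw [Nat.cast_sub k.pos]; field_simp; push_cast; ring
  have hms : ∀ j : ℕ, mid k (j + 1) = mid k j + 1 / k := by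
    intro j; unfold mid; push_cast; ring
  have hmono : ∀ {i j : ℕ}, i ≤ j → mid k i ≤ mid k j := by
    intro i j h
    rcases h.lt_or_eq with h | h
    · exact (mid_lt_mid.2 h).le
    · rw [h]
  have hp : (0 : ℝ) < 1 / k := by positivity
  rcases le_or_gt x (mid k 0) with h0 | h0
  · refine ⟨⟨0, k.pos⟩, ⟨0, k.pos⟩, 1, 0, zero_le_one, le_rfl, by norm_num, ?_, ?_, ?_,
      Or.inr (Or.inl ⟨rfl, h0, by simp only [hm0]; linarith⟩)⟩
    · simp only; rw [abs_le]; constructor <;> linarith [hx.1]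
    · simp only; rw [abs_le]; constructor <;> linarith [hx.1]
    · intro w
      rw [polygon_eq, indicator_of_mem (show x ∈ Icc 0 (mid k 0) from ⟨hx.1, h0⟩),
        Finset.sum_eq_zero, indicator_of_notMem]
      · ring
      · exact fun h => absurd h.1 (not_lt.2 (h0.trans (hmono (Nat.zero_le _))))
      · intro j _
        rw [indicator_of_notMem]
        exact fun h => absurd h.1 (not_lt.2 (h0.trans (hmono (Nat.zero_le _))))
  rcases lt_or_ge (mid k ((k : ℕ) - 1)) x with h1 | h1
  · have hl : (k : ℕ) - 1 < k := Nat.sub_lt k.pos Nat.one_pos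
    refine ⟨⟨_, hl⟩, ⟨_, hl⟩, 1, 0, zero_le_one, le_rfl, by norm_num, ?_, ?_, ?_,
      Or.inr (Or.inr ⟨rfl, h1.le, by simp only [hm1]; linarith⟩)⟩
    · simp only; rw [abs_le]; constructor <;> linarith [hx.2]
    · simp only; rw [abs_le]; constructor <;> linarith [hx.2]
    · intro w
      rw [polygon_eq, indicator_of_mem (show x ∈ Ioc (mid k ((k : ℕ) - 1)) 1 from ⟨h1, hx.2⟩),
        Finset.sum_eq_zero, indicator_of_notMem]
      · ring
      · exact fun h => absurd h.2 (not_le.2 h0)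
      · intro j _
        rw [indicator_of_notMem]
        exact fun h => absurd h.2 (not_le.2 ((hmono (by omega)).trans_lt h1))
  -- Since `mid k j = (j + 1/2) / k`, the cell containing `x` has the index `⌈x k - 1/2⌉ - 1`.
  · obtain ⟨j, hj, hj1, hj2⟩ : ∃ j : ℕ, j + 1 < k ∧ mid k j < x ∧ x ≤ mid k (j + 1) := by
      have hpos : 0 < x * k - 1 / 2 := by
        have : mid k 0 * k < x * k := by gcongr
        rw [hm0] at this
        nlinarith
      have hc : 0 < ⌈x * k - 1 / 2⌉₊ := Nat.ceil_pos.2 hpos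
      obtain ⟨j, hj⟩ : ∃ j, ⌈x * k - 1 / 2⌉₊ = j + 1 := ⟨_, (Nat.succ_pred_eq_of_pos hc).symm⟩
      have h2 : (j : ℝ) < x * k - 1 / 2 := by
        have := Nat.ceil_lt_add_one hpos.le
        rw [hj] at this; push_cast at this; linarith
      have h3 : x * k - 1 / 2 ≤ j + 1 := by
        have := Nat.le_ceil (x * k - 1 / 2)
        rw [hj] at this; push_cast at this; linarith
      have hj1 : mid k j < x := by
        unfold mid; rw [div_lt_iff₀ hk]; linarith
      refine ⟨j, ?_, hj1, ?_⟩
      · have := mid_lt_mid.1 (hj1.trans_le h1)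
        omega
      · unfold mid; rw [le_div_iff₀ hk]; push_cast; linarith
    refine ⟨⟨j, by omega⟩, ⟨j + 1, hj⟩, k * (mid k (j + 1) - x), k * (x - mid k j), ?_, ?_, ?_,
      ?_, ?_, ?_, Or.inl ?_⟩
    · have : 0 ≤ mid k (j + 1) - x := by linarith
      positivity
    · have : 0 ≤ x - mid k j := by linarith
      positivity
    · rw [hms]; linear_combination hkk
    · simp only; rw [hms] at hj2; rw [abs_le]; constructor <;> linarith
    · simp only; rw [hms] at hj2 ⊢; rw [abs_le]; constructor <;> linarith
    · intro w
      rw [polygon_eq, indicator_of_notMem (fun h => absurd h.2 (not_le.2 h0)),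
        indicator_of_notMem (fun h => absurd h.1 (not_lt.2 h1)),
        Finset.sum_eq_single ⟨j, by omega⟩]
      · rw [indicator_of_mem (show x ∈ Ioc (mid k j) (mid k (j + 1)) from ⟨hj1, hj2⟩)]
        ring
      · intro i _ hi
        rw [indicator_of_notMem]
        intro h
        apply hi
        have h1 := mid_lt_mid.1 (h.1.trans_le hj2)
        have h2 := mid_lt_mid.1 (hj1.trans_le h.2)
        ext
        simp only
        omega
      · simp
    · simp only; rw [hms]; linear_combination x * hkk

theorem polygon_mono {k : ℕ+} {w v : Fin k → ℝ} (h : w ≤ v) {x : ℝ} (hx : x ∈ Icc (0 : ℝ) 1) :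
    polygon k w x ≤ polygon k v x := by
  obtain ⟨i, j, a, b, ha, hb, -, -, -, hp, -⟩ := exists_polygon_eq k hx
  rw [hp, hp]
  gcongr
  exacts [h i, h j]

theorem polygon_const {k : ℕ+} (c : ℝ) {x : ℝ} (hx : x ∈ Icc (0 : ℝ) 1) :
    polygon k (fun _ => c) x = k * c := by
  obtain ⟨i, j, a, b, -, -, hab, -, -, hp, -⟩ := exists_polygon_eq k hx
  rw [hp, ← add_mul, hab, one_mul]

theorem polygon_add {k : ℕ+} (w v : Fin k → ℝ) {x : ℝ} (hx : x ∈ Icc (0 : ℝ) 1) :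
    polygon k (fun j => w j + v j) x = polygon k w x + polygon k v x := by
  obtain ⟨i, j, a, b, -, -, -, -, -, hp, -⟩ := exists_polygon_eq k hx
  rw [hp, hp, hp]
  ring

theorem polygon_div {k : ℕ+} (w : Fin k → ℝ) (c : ℝ) {x : ℝ} (hx : x ∈ Icc (0 : ℝ) 1) :
    polygon k (fun j => w j / c) x = polygon k w x / c := by
  obtain ⟨i, j, a, b, -, -, -, -, -, hp, -⟩ := exists_polygon_eq k hx
  rw [hp, hp]
  ring

theorem polygon_nonneg {k : ℕ+} {w : Fin k → ℝ} (h : ∀ j, 0 ≤ w j) {x : ℝ}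
    (hx : x ∈ Icc (0 : ℝ) 1) : 0 ≤ polygon k w x := by
  have := polygon_mono (w := fun _ => 0) h hx
  rwa [polygon_const 0 hx, mul_zero] at this

theorem measurable_polygon_right (k : ℕ+) (w : Fin k → ℝ) : Measurable (polygon k w) := by
  have h := (measurable_polygon k).comp (measurable_prodMk_left (x := w))
  exact h

instance : IsProbabilityMeasure lam := ⟨by simp [lam]⟩

theorem ae_lam_mem : ∀ᵐ x ∂lam, x ∈ Icc (0 : ℝ) 1 := ae_restrict_mem measurableSet_Icc

theorem integrable_polygon (k : ℕ+) (w : Fin k → ℝ) : Integrable (polygon k w) lam := by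
  refine Integrable.of_bound (measurable_polygon_right k w).aestronglyMeasurable
    (k * ∑ j, |w j|) ?_
  filter_upwards [ae_lam_mem] with x hx
  have hle : ∀ i, |w i| ≤ ∑ j, |w j| := fun i =>
    Finset.single_le_sum (fun j _ => abs_nonneg (w j)) (Finset.mem_univ i)
  have h1 := polygon_mono (w := w) (v := fun _ => ∑ j, |w j|)
    (fun i => (le_abs_self _).trans (hle i)) hx
  have h2 := polygon_mono (w := fun _ => - ∑ j, |w j|) (v := w)
    (fun i => neg_le_of_neg_le ((neg_le_abs _).trans (hle i))) hx
  rw [polygon_const _ hx] at h1 h2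
  rw [Real.norm_eq_abs, abs_le]
  constructor <;> linarith

theorem integral_indicator_Ioc_lam {a b : ℝ} (ha : 0 ≤ a) (hab : a ≤ b) (hb : b ≤ 1) (g : ℝ → ℝ) :
    ∫ x, (Ioc a b).indicator g x ∂lam = ∫ x in a..b, g x := by
  rw [integral_indicator measurableSet_Ioc, lam, Measure.restrict_restrict measurableSet_Ioc,
    inter_eq_left.2, intervalIntegral.integral_of_le hab]
  exact fun x hx => ⟨ha.trans hx.1.le, hx.2.trans hb⟩

/-- Trapezoidal rule: an inner cell contributes the mean of its two weights, and each outer half-bin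
contributes half of its weight, so every weight is counted exactly once. -/
theorem integral_polygon (k : ℕ+) (w : Fin k → ℝ) : ∫ x, polygon k w x ∂lam = ∑ j, w j := by
  have hk : (0 : ℝ) < k := by exact_mod_cast k.pos
  have hk1 : (1 : ℝ) ≤ k := by exact_mod_cast k.pos
  have hm0 : mid k 0 = 1 / 2 * (1 / k) := by unfold mid; push_cast; ring
  have hm1 : mid k ((k : ℕ) - 1) = 1 - 1 / 2 * (1 / k) := by
    unfold mid; rw [Nat.cast_sub k.pos]; field_simp; push_cast; ring
  have hms : ∀ j : ℕ, mid k (j + 1) = mid k j + 1 / k := by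
    intro j; unfold mid; push_cast; ring
  have hnn : ∀ j : ℕ, 0 ≤ mid k j := fun j => by unfold mid; positivity
  have hle : ∀ j : ℕ, j < k → mid k j ≤ 1 := by
    intro j hj
    have : (j : ℝ) + 1 ≤ k := by exact_mod_cast hj
    unfold mid; rw [div_le_one hk]; linarith
  have hcongr : polygon k w =ᵐ[lam] fun x =>
      (Ioc 0 (mid k 0)).indicator (fun _ => w ⟨0, k.pos⟩ * k) x
      + ∑ j : Fin ((k : ℕ) - 1), (Ioc (mid k j) (mid k (j + 1))).indicator
        (fun y => ((k : ℝ) * (mid k (j + 1) - y) * w ⟨j, by omega⟩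
          + (k : ℝ) * (y - mid k j) * w ⟨j + 1, by omega⟩) * k) x
      + (Ioc (mid k ((k : ℕ) - 1)) 1).indicator
        (fun _ => w ⟨(k : ℕ) - 1, Nat.sub_lt k.pos Nat.one_pos⟩ * k) x := by
    have h0 : ∀ᵐ x ∂lam, x ≠ 0 := by
      refine ae_restrict_of_ae ?_
      simp [ae_iff]
    filter_upwards [h0] with x hx
    rw [polygon_eq]
    congr 2
    by_cases h : x ∈ Icc 0 (mid k 0)
    · rw [indicator_of_mem h, indicator_of_mem
        (show x ∈ Ioc 0 (mid k 0) from ⟨lt_of_le_of_ne h.1 hx.symm, h.2⟩)]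
    · rw [indicator_of_notMem h, indicator_of_notMem fun h' => h ⟨h'.1.le, h'.2⟩]
  have hint : ∀ (a b : ℝ) (g : ℝ → ℝ), Continuous g →
      Integrable (fun x => (Ioc a b).indicator g x) lam := by
    intro a b g hg
    refine Integrable.indicator ?_ measurableSet_Ioc
    exact hg.continuousOn.integrableOn_Icc
  have hcell : ∀ (m a b : ℝ), ∫ y in m..(m + 1 / k),
      ((k : ℝ) * (m + 1 / k - y) * a + (k : ℝ) * (y - m) * b) * k = (a + b) / 2 := by
    intro m a b
    have : (fun y : ℝ => ((k : ℝ) * (m + 1 / k - y) * a + (k : ℝ) * (y - m) * b) * k)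
        = fun y => (k : ℝ) ^ 2 * (b - a) * y + (k : ℝ) ^ 2 * ((m + 1 / k) * a - m * b) := by
      ext y; ring
    rw [this, intervalIntegral.integral_add, intervalIntegral.integral_const_mul, integral_id,
      intervalIntegral.integral_const]
    · simp only [smul_eq_mul]
      field_simp
      ring
    · exact (Continuous.intervalIntegrable (by fun_prop) _ _)
    · exact (Continuous.intervalIntegrable (by fun_prop) _ _)
  rw [integral_congr_ae hcongr, integral_add, integral_add, integral_finsetSum]
  rotate_left
  · exact fun j _ => hint _ _ _ (by fun_prop)
  · exact hint _ _ _ (by fun_prop)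
  · exact integrable_finsetSum _ fun j _ => hint _ _ _ (by fun_prop)
  · exact (hint _ _ _ (by fun_prop)).add
      (integrable_finsetSum _ fun j _ => hint _ _ _ (by fun_prop))
  · exact hint _ _ _ (by fun_prop)
  -- Extending the weights by zero to `ℕ` allows the index shift in sums over `Finset.range`.
  set W : ℕ → ℝ := fun j => if h : j < k then w ⟨j, h⟩ else 0 with hW
  have hWw : ∀ (j : ℕ) (h : j < k), w ⟨j, h⟩ = W j := fun j h => by simp [hW, h]
  have hsum : ∀ j : Fin ((k : ℕ) - 1), ∫ x, (Ioc (mid k j) (mid k (j + 1))).indicator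
        (fun y => ((k : ℝ) * (mid k (j + 1) - y) * w ⟨j, by omega⟩
          + (k : ℝ) * (y - mid k j) * w ⟨j + 1, by omega⟩) * k) x ∂lam
        = (W j + W (j + 1)) / 2 := by
    intro j
    rw [integral_indicator_Ioc_lam (hnn _) (by rw [hms]; linarith [show 0 < 1 / (k : ℝ) by positivity])
      (hle _ (by omega)), hms, hcell, hWw, hWw]
  rw [integral_indicator_Ioc_lam le_rfl (hnn _) (hle _ k.pos),
    integral_indicator_Ioc_lam (hnn _) (hle _ (Nat.sub_lt k.pos Nat.one_pos)) le_rfl,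
    intervalIntegral.integral_const, intervalIntegral.integral_const, hm0, hm1, hWw, hWw,
    Finset.sum_congr rfl fun j _ => hsum j,
    Finset.sum_congr rfl fun (j : Fin k) _ => hWw j j.2, ← Finset.sum_range fun j => W j,
    ← Finset.sum_range fun j => (W j + W (j + 1)) / 2, smul_eq_mul, smul_eq_mul]
  obtain ⟨m, hm⟩ : ∃ m, (k : ℕ) = m + 1 := ⟨(k : ℕ) - 1, (Nat.sub_add_cancel k.pos).symm⟩
  have e1 : (1 / 2 * (1 / (k : ℝ)) - 0) * (W 0 * k) = W 0 / 2 := by field_simp; ring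
  have e2 : (1 - (1 - 1 / 2 * (1 / (k : ℝ)))) * (W ((k : ℕ) - 1) * k) = W ((k : ℕ) - 1) / 2 := by
    field_simp; ring
  rw [e1, e2, hm, Nat.add_sub_cancel, ← Finset.sum_div, Finset.sum_add_distrib]
  have e3 := Finset.sum_range_succ W m
  have e4 := Finset.sum_range_succ' W m
  linarith

theorem lintegral_polygon (k : ℕ+) {w : Fin k → ℝ} (hw : ∀ j, 0 ≤ w j) :
    ∫⁻ x, ENNReal.ofReal (polygon k w x) ∂lam = ENNReal.ofReal (∑ j, w j) := by
  rw [← integral_polygon, ofReal_integral_eq_lintegral_ofReal (integrable_polygon k w)]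
  filter_upwards [ae_lam_mem] with x hx
  exact polygon_nonneg hw hx

/-! ### Approximation by polygons -/

theorem mid_mem_Icc (k : ℕ+) (j : Fin k) : mid k j ∈ Icc (0 : ℝ) 1 := by
  have hk : (0 : ℝ) < k := by exact_mod_cast k.pos
  have : (j : ℝ) + 1 ≤ k := by exact_mod_cast j.2
  unfold mid
  exact ⟨by positivity, by rw [div_le_one hk]; linarith⟩

/-- On an inner cell the convex combination of midpoints equals `x`, so the linear Taylor terms
cancel. On an outer half-bin, `x` and the midpoint are both compared with the endpoint, where the
slope `d` vanishes; this causes the factor `2`. -/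
theorem abs_polygon_sub_le {β L : ℝ} (hβ : 0 < β) (hL : 0 ≤ L) {f d : ℝ → ℝ}
    (hd : ∀ x ∈ Icc (0 : ℝ) 1, ∀ y ∈ Icc (0 : ℝ) 1, |f y - f x - d x * (y - x)| ≤ L * |y - x| ^ β)
    (h0 : d 0 = 0) (h1 : d 1 = 0) (k : ℕ+) {x : ℝ} (hx : x ∈ Icc (0 : ℝ) 1) :
    |polygon k (fun j => f (mid k j) / k) x - f x| ≤ 2 * L * (k : ℝ) ^ (-β) := by
  have hk : (0 : ℝ) < k := by exact_mod_cast k.pos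
  obtain ⟨i, j, a, b, ha, hb, hab, hi, hj, hp, hc⟩ := exists_polygon_eq k hx
  have hpow : ∀ t : ℝ, |t| ≤ 1 / k → L * |t| ^ β ≤ L * (k : ℝ) ^ (-β) := by
    intro t ht
    rw [Real.rpow_neg hk.le, ← Real.inv_rpow hk.le, ← one_div]
    gcongr
  have hval : polygon k (fun j => f (mid k j) / k) x = a * f (mid k i) + b * f (mid k j) := by
    rw [hp]; field_simp
  have hLk : 0 ≤ L * (k : ℝ) ^ (-β) := by positivity
  rw [hval]
  rcases hc with hc | ⟨hij, hxm, hm⟩ | ⟨hij, hxm, hm⟩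
  · have e : a * f (mid k i) + b * f (mid k j) - f x
        = a * (f (mid k i) - f x - d x * (mid k i - x))
          + b * (f (mid k j) - f x - d x * (mid k j - x)) := by
      rw [← hc]; linear_combination (f (a * mid k i + b * mid k j)
        - d (a * mid k i + b * mid k j) * (a * mid k i + b * mid k j)) * hab
    have h2 := (hd x hx _ (mid_mem_Icc k i)).trans (hpow _ hi)
    have h3 := (hd x hx _ (mid_mem_Icc k j)).trans (hpow _ hj)
    calc _ ≤ a * |f (mid k i) - f x - d x * (mid k i - x)|
          + b * |f (mid k j) - f x - d x * (mid k j - x)| := by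
          rw [e]
          refine (abs_add_le _ _).trans ?_
          rw [abs_mul, abs_mul, abs_of_nonneg ha, abs_of_nonneg hb]
      _ ≤ a * (L * (k : ℝ) ^ (-β)) + b * (L * (k : ℝ) ^ (-β)) := by gcongr
      _ = L * (k : ℝ) ^ (-β) := by rw [← add_mul, hab, one_mul]
      _ ≤ _ := by linarith
  · subst hij
    have z : (0 : ℝ) ∈ Icc (0 : ℝ) 1 := by simp
    have h2 := (hd 0 z _ (mid_mem_Icc k i)).trans
      (hpow _ (by rw [sub_zero, abs_of_nonneg (mid_mem_Icc k i).1]; exact hm))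
    have h3 := (hd 0 z x hx).trans
      (hpow _ (by rw [sub_zero, abs_of_nonneg hx.1]; exact hxm.trans hm))
    rw [h0, zero_mul, sub_zero] at h2 h3
    rw [← add_mul, hab, one_mul]
    rw [abs_le] at *
    constructor <;> linarith
  · subst hij
    have z : (1 : ℝ) ∈ Icc (0 : ℝ) 1 := by simp
    have h2 := (hd 1 z _ (mid_mem_Icc k i)).trans
      (hpow _ (by rw [abs_sub_comm, abs_of_nonneg (by linarith [(mid_mem_Icc k i).2])]; exact hm))
    have h3 := (hd 1 z x hx).trans
      (hpow _ (by rw [abs_sub_comm, abs_of_nonneg (by linarith [hx.2])]; linarith))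
    rw [h1, zero_mul, sub_zero] at h2 h3
    rw [← add_mul, hab, one_mul]
    rw [abs_le] at *
    constructor <;> linarith

/-- Mean value inequality on the segment from `x` to `y` for `z ↦ f z - f'(x) z`. -/
theorem holder_taylor {β L : ℝ} (hβ : 1 < β) (hL : 0 ≤ L) {f : ℝ → ℝ}
    (hf : DifferentiableOn ℝ f (Icc 0 1))
    (h : ∀ x ∈ Icc (0 : ℝ) 1, ∀ y ∈ Icc (0 : ℝ) 1,
      |derivWithin f (Icc 0 1) x - derivWithin f (Icc 0 1) y| ≤ L * |x - y| ^ (β - 1))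
    {x y : ℝ} (hx : x ∈ Icc (0 : ℝ) 1) (hy : y ∈ Icc (0 : ℝ) 1) :
    |f y - f x - derivWithin f (Icc 0 1) x * (y - x)| ≤ L * |y - x| ^ β := by
  set d := derivWithin f (Icc 0 1)
  have hsub : uIcc x y ⊆ Icc 0 1 := uIcc_subset_Icc hx hy
  have hg : ∀ z ∈ uIcc x y, HasDerivWithinAt (fun z => f z - d x * z) (d z - d x) (uIcc x y) z := by
    intro z hz
    have h1 := ((hf z (hsub hz)).hasDerivWithinAt.mono hsub)
    have h2 := h1.sub ((hasDerivWithinAt_id z (uIcc x y)).const_mul (d x))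
    rw [mul_one] at h2
    exact h2
  have hb : ∀ z ∈ uIcc x y, ‖d z - d x‖ ≤ L * |y - x| ^ (β - 1) := by
    intro z hz
    refine (h z (hsub hz) x hx).trans ?_
    have : |z - x| ≤ |y - x| := abs_sub_left_of_mem_uIcc hz
    gcongr
  have := (convex_uIcc x y).norm_image_sub_le_of_norm_hasDerivWithin_le hg hb
    left_mem_uIcc right_mem_uIcc
  have e : f y - d x * y - (f x - d x * x) = f y - f x - d x * (y - x) := by ring
  rw [e, Real.norm_eq_abs, Real.norm_eq_abs] at this
  refine this.trans (le_of_eq ?_)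
  rcases eq_or_ne y x with rfl | hne
  · rw [sub_self, abs_zero, mul_zero, Real.zero_rpow (by linarith), mul_zero]
  · have : 0 < |y - x| := abs_pos.2 (sub_ne_zero.2 hne)
    rw [mul_assoc, Real.rpow_sub_one this.ne', div_mul_cancel₀ _ this.ne']

theorem eq_zero_of_isLittleO_rpow {g r : ℝ → ℝ} {l : Filter ℝ} [l.NeBot] {c p y : ℝ} (hp : 0 < p)
    (hr : Tendsto r l (𝓝 0)) (hg : (fun x => g x - c * r x ^ p) =o[l] fun x => r x ^ p)
    (hy : Tendsto g l (𝓝 y)) : y = 0 := by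
  have h0 : Tendsto (fun x => r x ^ p) l (𝓝 0) := by
    have := hr.rpow_const (p := p) (Or.inr hp.le)
    rwa [Real.zero_rpow hp.ne'] at this
  have h1 := (hg.isBigO.trans_tendsto h0).add (h0.const_mul c)
  simp only [sub_add_cancel, mul_zero, add_zero] at h1
  exact tendsto_nhds_unique hy h1

/-- Treats both smoothness regimes at once: the slope is `0` for `β ≤ 1` and `f'` for `β > 1`. The
boundary conditions enter only here, through `p, q ≥ β - 1 > 0`, which together with the continuity
of `f'` makes `f'` vanish at both endpoints. -/
theorem exists_taylor_slope {β : ℝ} (hβ : 0 < β) (hβ2 : β ≤ 2) {f : ℝ → ℝ}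
    (hf : HolderSmooth β f) (hBC : 1 < β → BC1 β f ∧ BC2 β f) :
    ∃ L : ℝ, 0 < L ∧ ∃ d : ℝ → ℝ, d 0 = 0 ∧ d 1 = 0 ∧
      ∀ x ∈ Icc (0 : ℝ) 1, ∀ y ∈ Icc (0 : ℝ) 1,
        |f y - f x - d x * (y - x)| ≤ L * |y - x| ^ β := by
  obtain ⟨hC, L, hL, hH⟩ := hf
  refine ⟨L, hL, ?_⟩
  rcases le_or_gt β 1 with h1 | h1
  · have hc : ⌈β⌉₊ = 1 := by
      rw [Nat.ceil_eq_iff one_ne_zero]; simpa using ⟨hβ, h1⟩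
    refine ⟨fun _ => 0, rfl, rfl, fun x hx y hy => ?_⟩
    have := hH y hy x hx
    rw [hc] at this
    simpa using this
  · have hc : ⌈β⌉₊ = 2 := by
      rw [Nat.ceil_eq_iff two_ne_zero]; push_cast; constructor <;> linarith
    rw [hc] at hH hC
    simp only [Nat.reduceSub, Nat.cast_one, iteratedDerivWithin_one] at hH hC
    have hlim : ∀ z ∈ Icc (0 : ℝ) 1, Tendsto (derivWithin f (Icc 0 1)) (𝓝[Icc 0 1] z)
        (𝓝 (derivWithin f (Icc 0 1) z)) := by
      intro z hz
      rw [tendsto_iff_norm_sub_tendsto_zero]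
      have hb : Tendsto (fun x => L * |x - z| ^ (β - 1)) (𝓝[Icc 0 1] z) (𝓝 0) := by
        have : ContinuousAt (fun x => L * |x - z| ^ (β - 1)) z := by
          refine ContinuousAt.mul continuousAt_const (ContinuousAt.rpow_const ?_ ?_)
          · fun_prop
          · right; linarith
        have h := this.tendsto
        rw [sub_self, abs_zero, Real.zero_rpow (by linarith), mul_zero] at h
        exact h.mono_left nhdsWithin_le_nhds
      refine squeeze_zero' (Eventually.of_forall fun _ => norm_nonneg _) ?_ hb
      filter_upwards [self_mem_nhdsWithin] with x hx
      exact hH x hx z hz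
    obtain ⟨⟨a₀, p, hp, h0⟩, ⟨b₀, q, hq, h1'⟩⟩ := hBC h1
    refine ⟨derivWithin f (Icc 0 1), ?_, ?_, fun x hx y hy =>
      holder_taylor h1 hL.le (hC.differentiableOn (by norm_num)) hH hx hy⟩
    · refine eq_zero_of_isLittleO_rpow (r := fun x => x) (l := 𝓝[>] 0) (p := p) (by linarith)
        (tendsto_id.mono_left nhdsWithin_le_nhds) h0 ((hlim 0 (by simp)).mono_left ?_)
      exact nhdsWithin_le_of_mem (Icc_mem_nhdsGT zero_lt_one)
    · refine eq_zero_of_isLittleO_rpow (r := fun x => 1 - x) (l := 𝓝[<] 1) (p := q) (by linarith)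
        ?_ h1' ((hlim 1 (by simp)).mono_left ?_)
      · have : ContinuousAt (fun x : ℝ => 1 - x) 1 := by fun_prop
        have h := this.tendsto
        rw [sub_self] at h
        exact h.mono_left nhdsWithin_le_nhds
      · exact nhdsWithin_le_of_mem (Icc_mem_nhdsLT zero_lt_one)

theorem exists_polygon_approx {β : ℝ} (hβ : 0 < β) (hβ2 : β ≤ 2) {f : ℝ → ℝ}
    (hf : HolderSmooth β f) (hBC : 1 < β → BC1 β f ∧ BC2 β f) :
    ∃ A : ℝ, 1 ≤ A ∧ ∀ (k : ℕ+), ∀ x ∈ Icc (0 : ℝ) 1,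
      |polygon k (fun j => f (mid k j) / k) x - f x| ≤ A * (k : ℝ) ^ (-β) := by
  obtain ⟨L, hL, d, h0, h1, hd⟩ := exists_taylor_slope hβ hβ2 hf hBC
  refine ⟨max 1 (2 * L), le_max_left _ _, fun k x hx => ?_⟩
  refine (abs_polygon_sub_le hβ hL.le hd h0 h1 k hx).trans ?_
  gcongr
  exact le_max_right _ _

/-! ### Prior mass of chi-square neighbourhoods -/

/-- Rests on `q²/p + p = 2q + (p - q)²/p` and `1/p ≤ S/q`. Adding `p` on the left avoids subtraction
in `ℝ≥0∞`; where `q = 0` the right side is infinite. -/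
theorem chiSq_pointwise {q p e S : ℝ} (hq : 0 ≤ q) (he : 0 < e) (hS : 0 < S) (hp : q / S ≤ p)
    (hpq : |p - q| ≤ e) :
    ENNReal.ofReal q * (ENNReal.ofReal p / ENNReal.ofReal q)⁻¹ + ENNReal.ofReal p
      ≤ 2 * ENNReal.ofReal q + ENNReal.ofReal (e ^ 2 * S) * (ENNReal.ofReal q)⁻¹ := by
  rcases hq.eq_or_lt with rfl | hq
  · have : ENNReal.ofReal (e ^ 2 * S) ≠ 0 := by
      rw [Ne, ENNReal.ofReal_eq_zero, not_le]; positivity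
    simp [ENNReal.mul_top this]
  have hp0 : 0 < p := (div_pos hq hS).trans_le hp
  rw [← ENNReal.ofReal_div_of_pos hq, ← ENNReal.ofReal_inv_of_pos (by positivity),
    ← ENNReal.ofReal_inv_of_pos hq, ← ENNReal.ofReal_mul hq.le, ← ENNReal.ofReal_mul (by positivity),
    ← ENNReal.ofReal_add (by positivity) hp0.le, ← ENNReal.ofReal_ofNat 2,
    ← ENNReal.ofReal_mul (by positivity), ← ENNReal.ofReal_add (by positivity) (by positivity)]
  apply ENNReal.ofReal_le_ofReal
  have e1 : q * (p / q)⁻¹ + p = 2 * q + (p - q) ^ 2 * p⁻¹ := by field_simp; ring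
  rw [e1, mul_assoc]
  have h2 : (p - q) ^ 2 ≤ e ^ 2 := sq_le_sq' (abs_le.1 hpq).1 (abs_le.1 hpq).2
  have h3 : p⁻¹ ≤ S * q⁻¹ := by
    rw [← div_eq_mul_inv, ← inv_div]
    exact inv_anti₀ (by positivity) hp
  gcongr

theorem lintegral_chiSq_le {f p : ℝ → ℝ} (hf : Measurable f) (hd : IsDensity f)
    (hpm : Measurable p) (hp1 : ∫⁻ x, ENNReal.ofReal (p x) ∂lam = 1) {e S : ℝ} (he : 0 < e)
    (hS : 0 < S) (hp : ∀ x ∈ Icc (0 : ℝ) 1, f x / S ≤ p x)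
    (hpq : ∀ x ∈ Icc (0 : ℝ) 1, |p x - f x| ≤ e) :
    ∫⁻ x, ENNReal.ofReal (f x) * (ENNReal.ofReal (p x) / ENNReal.ofReal (f x))⁻¹ ∂lam
      ≤ 1 + ENNReal.ofReal (e ^ 2 * S) * ∫⁻ x, (ENNReal.ofReal (f x))⁻¹ ∂lam := by
  have h : ∫⁻ x, (ENNReal.ofReal (f x) * (ENNReal.ofReal (p x) / ENNReal.ofReal (f x))⁻¹
        + ENNReal.ofReal (p x)) ∂lam
      ≤ ∫⁻ x, (2 * ENNReal.ofReal (f x)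
        + ENNReal.ofReal (e ^ 2 * S) * (ENNReal.ofReal (f x))⁻¹) ∂lam := by
    refine lintegral_mono_ae ?_
    filter_upwards [ae_lam_mem] with x hx
    exact chiSq_pointwise (hd.1 x hx) he hS (hp x hx) (hpq x hx)
  rw [lintegral_add_right _ (by fun_prop), hp1, lintegral_add_left (by fun_prop),
    lintegral_const_mul _ (by fun_prop), hd.2,
    lintegral_const_mul (f := fun x => (ENNReal.ofReal (f x))⁻¹) _ (by fun_prop), mul_one,
    ← one_add_one_eq_two, add_assoc, add_comm _ (1 : ℝ≥0∞)] at h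
  exact (ENNReal.add_le_add_iff_left ENNReal.one_ne_top).1 h

/-! ### Lower bounds for Gamma and Dirichlet probabilities -/

/-- Uniform down to `a = 0`: `1/Γ(a) = a/Γ(a+1)` with `Γ` bounded on `[1, C+1]`, which gives the
linear factor `a`. On the interval `x^{a-1} = x^a / x ≥ η^C / (V+1)`, because `η ≤ x ≤ V + 1`; the
length of the interval supplies the last factor `η`. -/
theorem exists_gammaMeasure_Icc_ge {C V : ℝ} (hV : 0 < V) :
    ∃ κ : ℝ, 0 < κ ∧ ∀ a ∈ Ioc 0 C, ∀ η ∈ Ioc (0 : ℝ) 1, ∀ v, η ≤ v → v ≤ V →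
      ENNReal.ofReal (κ * a * η ^ (C + 1)) ≤ gammaMeasure a 1 (Icc v (v + η)) := by
  have hcont : ContinuousOn Real.Gamma (Icc 1 (C + 1)) := by
    intro x hx
    refine (Real.differentiableAt_Gamma fun m => ?_).continuousAt.continuousWithinAt
    have : (0 : ℝ) ≤ m := Nat.cast_nonneg m
    linarith [hx.1]
  obtain ⟨G, hG⟩ := isCompact_Icc.exists_bound_of_continuousOn hcont
  have hGpos : 0 < max G 1 := by positivity
  refine ⟨Real.exp (-(V + 1)) / (max G 1 * (V + 1)), by positivity, fun a ha η hη v hηv hvV => ?_⟩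
  have hη0 := hη.1
  have hden : ∀ x ∈ Icc v (v + η), ENNReal.ofReal
      (Real.exp (-(V + 1)) / (max G 1 * (V + 1)) * a * η ^ C) ≤ gammaPDF a 1 x := by
    intro x hx
    have hx0 : 0 < x := by linarith [hx.1]
    have hxV : x ≤ V + 1 := by linarith [hx.2, hη.2]
    rw [gammaPDF_of_nonneg hx0.le]
    apply ENNReal.ofReal_le_ofReal
    rw [Real.one_rpow, one_mul]
    have hΓ : 0 < Real.Gamma a := Real.Gamma_pos_of_pos ha.1
    have h1 : a / max G 1 ≤ 1 / Real.Gamma a := by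
      rw [div_le_div_iff₀ hGpos hΓ, one_mul, ← Real.Gamma_add_one ha.1.ne']
      have := hG (a + 1) ⟨by linarith [ha.1], by linarith [ha.2]⟩
      exact (le_abs_self _).trans (this.trans (le_max_left _ _))
    have h2 : η ^ C / (V + 1) ≤ x ^ (a - 1) := by
      rw [Real.rpow_sub_one hx0.ne']
      have : η ^ C ≤ x ^ a :=
        (Real.rpow_le_rpow_of_exponent_ge hη0 hη.2 ha.2).trans
          (Real.rpow_le_rpow hη0.le (hηv.trans hx.1) ha.1.le)
      gcongr
    have h3 : Real.exp (-(V + 1)) ≤ Real.exp (-x) := Real.exp_le_exp.2 (by linarith)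
    have ha0 := ha.1
    calc _ = a / max G 1 * (η ^ C / (V + 1)) * Real.exp (-(V + 1)) := by field_simp
      _ ≤ _ := by gcongr
  rw [gammaMeasure, withDensity_apply _ measurableSet_Icc]
  refine le_trans ?_ (setLIntegral_mono' measurableSet_Icc hden)
  have ha0 := ha.1
  rw [setLIntegral_const, Real.volume_Icc, add_sub_cancel_left,
    ← ENNReal.ofReal_mul (by positivity), Real.rpow_add_one hη0.ne', mul_assoc _ (η ^ C)]

theorem measurable_normalize (k : ℕ) :
    Measurable fun (g : Fin k → ℝ) (j : Fin k) => g j / ∑ i, g i := by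
  fun_prop

theorem isProbabilityMeasure_dirichlet {k : ℕ} {a : Fin k → ℝ} (ha : ∀ j, 0 < a j) :
    IsProbabilityMeasure (dirichlet a) := by
  have : ∀ j, IsProbabilityMeasure (gammaMeasure (a j) 1) := fun j =>
    isProbabilityMeasure_gammaMeasure (ha j) one_pos
  exact Measure.isProbabilityMeasure_map (measurable_normalize k).aemeasurable

/-- Working with the independent Gamma variables before normalization replaces the Dirichlet density
on the simplex by a product of one-dimensional probabilities. -/
theorem prod_gammaMeasure_le_dirichlet {k : ℕ} {a : Fin k → ℝ} (ha : ∀ j, 0 < a j)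
    {s : Fin k → Set ℝ} {D : Set (Fin k → ℝ)}
    (h : ∀ g : Fin k → ℝ, (∀ j, g j ∈ s j) → (fun j => g j / ∑ i, g i) ∈ D) :
    ∏ j, gammaMeasure (a j) 1 (s j) ≤ dirichlet a D := by
  have : ∀ j, IsProbabilityMeasure (gammaMeasure (a j) 1) := fun j =>
    isProbabilityMeasure_gammaMeasure (ha j) one_pos
  rw [← Measure.pi_pi]
  refine le_trans (measure_mono fun g hg => ?_)
    (Measure.le_map_apply (measurable_normalize k).aemeasurable D)
  exact h g fun j => hg j (mem_univ j)

/-- The unit simplex. -/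
def simplex (k : ℕ) : Set (Fin k → ℝ) := {w | (∀ j, 0 ≤ w j) ∧ ∑ j, w j = 1}

theorem measurableSet_simplex (k : ℕ) : MeasurableSet (simplex k) := by
  have h1 : MeasurableSet {w : Fin k → ℝ | ∀ j, 0 ≤ w j} := by
    have : {w : Fin k → ℝ | ∀ j, 0 ≤ w j} = ⋂ j, {w | 0 ≤ w j} := by ext; simp
    rw [this]
    exact MeasurableSet.iInter fun j => measurableSet_le measurable_const (measurable_pi_apply j)
  have h2 : MeasurableSet {w : Fin k → ℝ | ∑ j, w j = 1} :=
    measurableSet_eq_fun (by fun_prop) measurable_const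
  exact h1.inter h2

theorem ae_gammaMeasure_pos {a : ℝ} : ∀ᵐ x ∂(gammaMeasure a 1), 0 < x := by
  rw [ae_iff]
  simp only [not_lt]
  have : {x : ℝ | x ≤ 0} = Iio 0 ∪ {0} := by
    ext x; simp [le_iff_lt_or_eq]
  rw [this]
  refine measure_union_null ?_ ?_
  · rw [gammaMeasure, withDensity_apply _ measurableSet_Iio]
    exact lintegral_gammaPDF_of_nonpos le_rfl
  · exact (withDensity_absolutelyContinuous volume _) (by simp)

theorem ae_dirichlet_mem_simplex {k : ℕ} (hk : 0 < k) {a : Fin k → ℝ} (ha : ∀ j, 0 < a j) :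
    ∀ᵐ w ∂(dirichlet a), w ∈ simplex k := by
  have : ∀ j, IsProbabilityMeasure (gammaMeasure (a j) 1) := fun j =>
    isProbabilityMeasure_gammaMeasure (ha j) one_pos
  have : Nonempty (Fin k) := ⟨⟨0, hk⟩⟩
  unfold dirichlet
  refine (ae_map_iff (p := fun w => w ∈ simplex k) (measurable_normalize k).aemeasurable
    (measurableSet_simplex k)).2 ?_
  have h : ∀ᵐ g ∂(Measure.pi fun j => gammaMeasure (a j) 1), ∀ j, 0 < g j := by
    rw [ae_all_iff]
    intro j
    exact (measurePreserving_eval (fun j => gammaMeasure (a j) 1) j).quasiMeasurePreserving.ae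
      ae_gammaMeasure_pos
  filter_upwards [h] with g hg
  have hs : 0 < ∑ i, g i := Finset.sum_pos (fun i _ => hg i) Finset.univ_nonempty
  refine ⟨fun j => (div_pos (hg j) hs).le, ?_⟩
  rw [← Finset.sum_div, div_self hs.ne']

/-- The chi-square ball around `f₀`, of radius `s - 1`. -/
def chiSqBall (f₀ : ℝ → ℝ) (s : ℝ≥0∞) : Set Param :=
  {θ | ∫⁻ x, ENNReal.ofReal (f₀ x)
    * (ENNReal.ofReal (θ.density x) / ENNReal.ofReal (f₀ x))⁻¹ ∂lam ≤ s}

theorem chiSqBall_subset (f₀ : ℝ → ℝ) {s t : ℝ≥0∞} (h : s ≤ t) :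
    chiSqBall f₀ s ⊆ chiSqBall f₀ t := fun _ hθ => le_trans hθ h

theorem measurableSet_chiSqBall {f₀ : ℝ → ℝ} (hf : Measurable f₀) (s : ℝ≥0∞) :
    MeasurableSet (chiSqBall f₀ s) := by
  have h : Measurable fun z : Param × ℝ => ENNReal.ofReal (f₀ z.2)
      * (ENNReal.ofReal (z.1.density z.2) / ENNReal.ofReal (f₀ z.2))⁻¹ := by
    have := measurable_density
    fun_prop
  have h2 := h.lintegral_prod_right' (ν := lam)
  exact measurableSet_le h2 measurable_const

/-- The upward shift `A r / k` absorbs the approximation error, so the polygon of `g` lies between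
`f` and `f + (2A+1) r`, and its mass `S` between `1` and `1 + (2A+1) r ≤ 2A + 2`. Division by `S`
keeps the lower bound `f / S` and moves the polygon away from `f` by at most `(2A+1) r (1+F)`. -/
theorem normalize_mem_chiSqBall {f : ℝ → ℝ} (hf : Measurable f) (hd : IsDensity f) {F A r : ℝ}
    (hF : ∀ x ∈ Icc (0 : ℝ) 1, f x ≤ F) (hA : 1 ≤ A) (hr : 0 < r) (hr1 : r ≤ 1) {k : ℕ+}
    (happ : ∀ x ∈ Icc (0 : ℝ) 1, |polygon k (fun j => f (mid k j) / k) x - f x| ≤ A * r)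
    {g : Fin k → ℝ}
    (hg : ∀ j : Fin k, g j ∈ Icc ((f (mid k j) + A * r) / k) ((f (mid k j) + A * r) / k + r / k)) :
    (⟨k, fun j => g j / ∑ i, g i⟩ : Param) ∈ chiSqBall f (1 + ENNReal.ofReal
      (((2 * A + 1) * r * (1 + F)) ^ 2 * (2 * A + 2)) * ∫⁻ x, (ENNReal.ofReal (f x))⁻¹ ∂lam) := by
  have hk : (0 : ℝ) < k := by exact_mod_cast k.pos
  have hF0 : 0 ≤ F := (hd.1 0 (by simp)).trans (hF 0 (by simp))
  have hg0 : ∀ j, 0 ≤ g j := fun j => by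
    refine le_trans ?_ (hg j).1
    have := hd.1 _ (mid_mem_Icc k j)
    positivity
  have hlow : ∀ x ∈ Icc (0 : ℝ) 1, f x ≤ polygon k g x := by
    intro x hx
    have h1 := polygon_mono (w := fun j => f (mid k j) / k + A * r / k) (v := g)
      (fun j => (le_of_eq (by ring)).trans (hg j).1) hx
    rw [polygon_add (fun j => f (mid k j) / k) (fun _ => A * r / k) hx, polygon_const _ hx,
      mul_div_cancel₀ _ hk.ne'] at h1
    linarith [(abs_le.1 (happ x hx)).1]
  have hupp : ∀ x ∈ Icc (0 : ℝ) 1, polygon k g x ≤ f x + (2 * A + 1) * r := by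
    intro x hx
    have h1 := polygon_mono (w := g) (v := fun j => f (mid k j) / k + (A * r + r) / k)
      (fun j => (hg j).2.trans (le_of_eq (by ring))) hx
    rw [polygon_add (fun j => f (mid k j) / k) (fun _ => (A * r + r) / k) hx, polygon_const _ hx,
      mul_div_cancel₀ _ hk.ne'] at h1
    linarith [(abs_le.1 (happ x hx)).2]
  have hint := lintegral_polygon k hg0
  set S := ∑ j, g j with hSdef
  have hS1 : 1 ≤ S := by
    rw [← ENNReal.one_le_ofReal, ← hint, ← hd.2]
    refine lintegral_mono_ae ?_
    filter_upwards [ae_lam_mem] with x hx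
    exact ENNReal.ofReal_le_ofReal (hlow x hx)
  have hS2 : S ≤ 1 + (2 * A + 1) * r := by
    rw [← ENNReal.ofReal_le_ofReal_iff (by positivity), ← hint]
    calc ∫⁻ x, ENNReal.ofReal (polygon k g x) ∂lam
        ≤ ∫⁻ x, (ENNReal.ofReal (f x) + ENNReal.ofReal ((2 * A + 1) * r)) ∂lam := by
          refine lintegral_mono_ae ?_
          filter_upwards [ae_lam_mem] with x hx
          rw [← ENNReal.ofReal_add (hd.1 x hx) (by positivity)]
          exact ENNReal.ofReal_le_ofReal (hupp x hx)
      _ = _ := by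
          rw [lintegral_add_right _ measurable_const, hd.2, lintegral_const, measure_univ, mul_one,
            ENNReal.ofReal_add zero_le_one (by positivity), ENNReal.ofReal_one]
  have hS0 : 0 < S := by linarith
  have hS3 : S ≤ 2 * A + 2 := by nlinarith
  refine lintegral_chiSq_le hf hd (measurable_polygon_right k _) ?_ ?_ ?_ ?_ ?_
  · show ∫⁻ x, ENNReal.ofReal (polygon k (fun j => g j / S) x) ∂lam = 1
    rw [lintegral_polygon k fun j => div_nonneg (hg0 j) hS0.le, ← Finset.sum_div, ← hSdef,
      div_self hS0.ne', ENNReal.ofReal_one]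
  · positivity
  · positivity
  · intro x hx
    show f x / (2 * A + 2) ≤ polygon k (fun j => g j / S) x
    rw [polygon_div g S hx]
    have := hd.1 x hx
    exact div_le_div₀ (this.trans (hlow x hx)) (hlow x hx) hS0 hS3
  · intro x hx
    show |polygon k (fun j => g j / S) x - f x| ≤ _
    rw [polygon_div g S hx]
    have h0 := hd.1 x hx
    have h1 := hlow x hx
    have h2 := hupp x hx
    have h3 := hF x hx
    have hDr : 0 ≤ (2 * A + 1) * r := by positivity
    rw [abs_le]
    constructor
    · rw [neg_le_sub_iff_le_add, ← sub_le_iff_le_add, le_div_iff₀ hS0]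
      -- The upper bound on `S` can be multiplied in only when the other factor is nonnegative;
      -- otherwise the claim is trivial.
      rcases le_or_gt (f x - (2 * A + 1) * r * (1 + F)) 0 with h | h
      · nlinarith
      · have : (f x - (2 * A + 1) * r * (1 + F)) * S
            ≤ (f x - (2 * A + 1) * r * (1 + F)) * (1 + (2 * A + 1) * r) := by gcongr
        nlinarith [mul_nonneg hDr (sub_nonneg.2 h3), mul_nonneg hDr hF0, mul_nonneg hDr hDr,
          mul_nonneg (mul_nonneg hDr hDr) hF0]
    · have : polygon k g x / S ≤ polygon k g x := div_le_self (h0.trans h1) hS1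
      nlinarith [mul_nonneg hDr hF0]

/-- Each of the `k` Gamma intervals has length `k^{-β-1}`, hence a probability bounded below by a
constant times a fixed power of `1/k`. The product over the bins costs `exp(-D k (1 + log k))`. -/
theorem exists_dirichlet_chiSqBall_ge {f : ℝ → ℝ} (hf : Measurable f) (hd : IsDensity f)
    {F A β c C : ℝ} (hF : ∀ x ∈ Icc (0 : ℝ) 1, f x ≤ F) (hA : 1 ≤ A) (hβ : 0 < β)
    (happ : ∀ (k : ℕ+), ∀ x ∈ Icc (0 : ℝ) 1,
      |polygon k (fun j => f (mid k j) / k) x - f x| ≤ A * (k : ℝ) ^ (-β))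
    (hJ : ∫⁻ x, (ENNReal.ofReal (f x))⁻¹ ∂lam < ⊤) (hc : 0 < c) :
    ∃ C₂ D : ℝ, 0 < C₂ ∧ 0 < D ∧ ∀ (k : ℕ+) (a : Fin k → ℝ), (∀ j, c / k ≤ a j ∧ a j ≤ C) →
      ENNReal.ofReal (Real.exp (-D * (k * (1 + Real.log k)))) ≤ dirichlet a
        {w | (⟨k, w⟩ : Param) ∈ chiSqBall f (1 + ENNReal.ofReal (C₂ * ((k : ℝ) ^ (-β)) ^ 2))} := by
  have hF0 : 0 ≤ F := (hd.1 0 (by simp)).trans (hF 0 (by simp))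
  obtain ⟨κ, hκ, hgam⟩ := exists_gammaMeasure_Icc_ge (C := C) (V := F + A) (by positivity)
  obtain ⟨J, hJ0, hJe⟩ : ∃ J : ℝ, 0 ≤ J ∧ ∫⁻ x, (ENNReal.ofReal (f x))⁻¹ ∂lam = ENNReal.ofReal J :=
    ⟨_, ENNReal.toReal_nonneg, (ENNReal.ofReal_toReal hJ.ne).symm⟩
  refine ⟨((2 * A + 1) * (1 + F)) ^ 2 * (2 * A + 2) * J + 1,
    |Real.log (κ * c)| + |(1 + (β + 1) * (C + 1))| + 1, by positivity, by positivity,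
    fun k a ha => ?_⟩
  have hk : (0 : ℝ) < k := by exact_mod_cast k.pos
  have hk1 : (1 : ℝ) ≤ k := by exact_mod_cast k.pos
  have hlog : 0 ≤ Real.log k := Real.log_nonneg hk1
  set r := (k : ℝ) ^ (-β) with hr
  have hr0 : 0 < r := by positivity
  have hr1 : r ≤ 1 := Real.rpow_le_one_of_one_le_of_nonpos hk1 (by linarith)
  have ha0 : ∀ j, 0 < a j := fun j => (div_pos hc hk).trans_le (ha j).1
  have hη0 : 0 < r / k := by positivity
  have hη1 : r / k ≤ 1 := by rw [div_le_one hk]; linarith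
  have hball := prod_gammaMeasure_le_dirichlet ha0
    (s := fun j : Fin k => Icc ((f (mid k j) + A * r) / k) ((f (mid k j) + A * r) / k + r / k))
    (D := {w | (⟨k, w⟩ : Param) ∈ chiSqBall f (1 + ENNReal.ofReal
      ((((2 * A + 1) * (1 + F)) ^ 2 * (2 * A + 2) * J + 1) * r ^ 2))}) (by
    intro g hg
    have h := normalize_mem_chiSqBall hf hd hF hA hr0 hr1 (happ k) hg
    refine chiSqBall_subset f ?_ h
    gcongr 1 + ?_
    rw [hJe, ← ENNReal.ofReal_mul (by positivity)]
    apply ENNReal.ofReal_le_ofReal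
    nlinarith [sq_nonneg r])
  refine le_trans ?_ hball
  have hfac : ∀ j : Fin k, ENNReal.ofReal (κ * (c / k) * (r / k) ^ (C + 1))
      ≤ gammaMeasure (a j) 1
        (Icc ((f (mid k j) + A * r) / k) ((f (mid k j) + A * r) / k + r / k)) := by
    intro j
    have hfm := hd.1 _ (mid_mem_Icc k j)
    refine le_trans ?_ (hgam (a j) ⟨ha0 j, (ha j).2⟩ (r / k) ⟨hη0, hη1⟩ _ ?_ ?_)
    · apply ENNReal.ofReal_le_ofReal
      gcongr
      exact (ha j).1
    -- The Gamma bound needs the left endpoint to be at least the length `r / k`; this is where `A ≥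
    -- 1` is used.
    · gcongr
      nlinarith
    · refine (div_le_self (by positivity) hk1).trans ?_
      have := hF _ (mid_mem_Icc k j)
      nlinarith
  refine le_trans ?_ (Finset.prod_le_prod' fun j _ => hfac j)
  rw [Finset.prod_const, Finset.card_univ, Fintype.card_fin, ← ENNReal.ofReal_pow (by positivity)]
  apply ENNReal.ofReal_le_ofReal
  have hpos : 0 < κ * (c / k) * (r / k) ^ (C + 1) := by positivity
  rw [← Real.exp_log hpos, ← Real.exp_nat_mul]
  apply Real.exp_le_exp.2
  have hl : Real.log (κ * (c / k) * (r / k) ^ (C + 1))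
      = Real.log (κ * c) - (1 + (β + 1) * (C + 1)) * Real.log k := by
    rw [show κ * (c / k) * (r / k) ^ (C + 1) = κ * c * ((k : ℝ)⁻¹ * (r / k) ^ (C + 1)) by ring,
      Real.log_mul (x := κ * c) (by positivity) (by positivity),
      Real.log_mul (x := (k : ℝ)⁻¹) (by positivity) (by positivity),
      Real.log_inv, Real.log_rpow hη0, Real.log_div hr0.ne' hk.ne', hr, Real.log_rpow hk]
    ring
  rw [hl]
  have h1 := neg_abs_le (Real.log (κ * c))
  have h2 := le_abs_self (1 + (β + 1) * (C + 1))
  have h3 := mul_le_mul_of_nonneg_right h2 hlog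
  have h4 : -(|Real.log (κ * c)| + |1 + (β + 1) * (C + 1)| + 1) * (1 + Real.log k)
      ≤ Real.log (κ * c) - (1 + (β + 1) * (C + 1)) * Real.log k := by
    nlinarith [abs_nonneg (Real.log (κ * c)), abs_nonneg (1 + (β + 1) * (C + 1)),
      mul_nonneg (abs_nonneg (Real.log (κ * c))) hlog]
  nlinarith

/-! ### The polygonally smoothed prior -/

theorem polygonPrior_apply (ρ : PMF ℕ+) (α : Measure ℝ) {S : Set Param} (hS : MeasurableSet S) :
    polygonPrior ρ α S = ∑' k : ℕ+, ρ k *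
      dirichlet (fun j : Fin k => (α (bin k j)).toReal) {w | (⟨k, w⟩ : Param) ∈ S} := by
  unfold polygonPrior
  rw [Measure.sum_apply _ hS]
  refine tsum_congr fun k => ?_
  rw [Measure.smul_apply, Measure.map_apply (measurableEmbedding_param k).measurable hS,
    smul_eq_mul]
  rfl

theorem bin_subset_Icc {k j : ℕ} (hj : j < k) : bin k j ⊆ Icc 0 1 := by
  have hk : (0 : ℝ) < k := by exact_mod_cast (Nat.zero_le j).trans_lt hj
  have hj1 : (j : ℝ) + 1 ≤ k := by exact_mod_cast hj
  have h1 : ((j : ℝ) + 1) / k ≤ 1 := by rwa [div_le_one hk]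
  unfold bin
  split_ifs with h
  · subst h
    simp only [Nat.cast_zero, zero_add] at h1
    exact Icc_subset_Icc le_rfl h1
  · exact fun x hx => ⟨(div_nonneg (Nat.cast_nonneg j) hk.le).trans hx.1.le, hx.2.trans h1⟩

theorem lam_bin {k j : ℕ} (hj : j < k) : lam (bin k j) = ENNReal.ofReal (1 / k) := by
  have hk : (0 : ℝ) < k := by exact_mod_cast (Nat.zero_le j).trans_lt hj
  rw [lam, Measure.restrict_apply (measurableSet_bin k j), inter_eq_left.2 (bin_subset_Icc hj)]
  unfold bin
  split_ifs with h
  · rw [Real.volume_Icc, sub_zero]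
  · rw [Real.volume_Ioc]
    congr 1
    ring

theorem exists_bin_bounds {a : ℝ → ℝ} (ha : ContinuousOn a (Icc 0 1))
    (ha' : ∀ x ∈ Icc (0 : ℝ) 1, 0 < a x) :
    ∃ c C : ℝ, 0 < c ∧ ∀ (k : ℕ+) (j : Fin k),
      c / k ≤ ((lam.withDensity fun x => ENNReal.ofReal (a x)) (bin k j)).toReal ∧
      ((lam.withDensity fun x => ENNReal.ofReal (a x)) (bin k j)).toReal ≤ C := by
  have hne : (Icc (0 : ℝ) 1).Nonempty := ⟨0, by simp⟩
  obtain ⟨x₀, hx₀, hmin⟩ := isCompact_Icc.exists_isMinOn hne ha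
  obtain ⟨x₁, hx₁, hmax⟩ := isCompact_Icc.exists_isMaxOn hne ha
  refine ⟨a x₀, a x₁, ha' _ hx₀, fun k j => ?_⟩
  have hk : (0 : ℝ) < k := by exact_mod_cast k.pos
  have hk1 : (1 : ℝ) ≤ k := by exact_mod_cast k.pos
  have hm := measurableSet_bin k j
  rw [withDensity_apply _ hm]
  have hlow : ENNReal.ofReal (a x₀ / k) ≤ ∫⁻ x in bin k j, ENNReal.ofReal (a x) ∂lam := by
    calc ENNReal.ofReal (a x₀ / k) = ∫⁻ _ in bin k j, ENNReal.ofReal (a x₀) ∂lam := by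
          rw [setLIntegral_const, lam_bin j.2, ← ENNReal.ofReal_mul (ha' _ hx₀).le, mul_one_div]
      _ ≤ _ := setLIntegral_mono' hm fun x hx =>
          ENNReal.ofReal_le_ofReal (hmin (bin_subset_Icc j.2 hx))
  have hupp : ∫⁻ x in bin k j, ENNReal.ofReal (a x) ∂lam ≤ ENNReal.ofReal (a x₁ / k) := by
    calc _ ≤ ∫⁻ _ in bin k j, ENNReal.ofReal (a x₁) ∂lam := setLIntegral_mono' hm fun x hx =>
          ENNReal.ofReal_le_ofReal (hmax (bin_subset_Icc j.2 hx))
      _ = _ := by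
          rw [setLIntegral_const, lam_bin j.2, ← ENNReal.ofReal_mul (ha' _ hx₁).le, mul_one_div]
  have hpos := ha' _ hx₁
  constructor
  · rw [← ENNReal.ofReal_le_iff_le_toReal (hupp.trans_lt ENNReal.ofReal_lt_top).ne]
    exact hlow
  · refine (ENNReal.toReal_le_of_le_ofReal (by positivity) hupp).trans ?_
    exact div_le_self hpos.le hk1

section Prior

variable {ρ : PMF ℕ+} {α : Measure ℝ}

theorem isProbabilityMeasure_polygonPrior
    (hpos : ∀ (k : ℕ+) (j : Fin k), 0 < (α (bin k j)).toReal) :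
    IsProbabilityMeasure (polygonPrior ρ α) := by
  constructor
  rw [polygonPrior_apply ρ α MeasurableSet.univ, ← ρ.tsum_coe]
  refine tsum_congr fun k => ?_
  have := isProbabilityMeasure_dirichlet (hpos k)
  simp

theorem measurableSet_simplex_param : MeasurableSet {θ : Param | θ.2 ∈ simplex θ.1} := by
  rw [measurableSet_param_iff]
  exact fun k => measurableSet_simplex k

theorem ae_polygonPrior_mem_simplex
    (hpos : ∀ (k : ℕ+) (j : Fin k), 0 < (α (bin k j)).toReal) :
    ∀ᵐ θ ∂(polygonPrior ρ α), θ.2 ∈ simplex θ.1 := by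
  rw [ae_iff]
  have hm : MeasurableSet {θ : Param | ¬ θ.2 ∈ simplex θ.1} := measurableSet_simplex_param.compl
  rw [polygonPrior_apply ρ α hm, ENNReal.tsum_eq_zero]
  intro k
  have h := ae_dirichlet_mem_simplex k.pos (hpos k)
  rw [ae_iff] at h
  rw [mul_eq_zero]
  exact Or.inr h

theorem measurableSet_param_fst (p : ℕ+ → Prop) : MeasurableSet {θ : Param | p θ.1} := by
  rw [measurableSet_param_iff]
  intro k
  by_cases h : p k
  · convert MeasurableSet.univ
    exact eq_univ_of_forall fun _ => h
  · convert MeasurableSet.empty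
    exact eq_empty_of_forall_notMem fun _ => h

/-- The exponent `β₂ k log k` is split into halves: one is at least `(β₂/2) K log K`, the other at
least `k` by `hK2`, which leaves a convergent geometric series. -/
theorem polygonPrior_fst_gt_le {B₂ β₂ : ℝ} (hB₂ : 0 < B₂) (hβ₂ : 0 < β₂)
    (hρ : ∀ k : ℕ+, (ρ k).toReal ≤ B₂ * Real.exp (-β₂ * (k : ℝ) * Real.log (k : ℝ)))
    (hpos : ∀ (k : ℕ+) (j : Fin k), 0 < (α (bin k j)).toReal) {K : ℝ} (hK : 1 ≤ K)
    (hK2 : 2 ≤ β₂ * Real.log K) :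
    polygonPrior ρ α {θ | K < (θ.1 : ℝ)}
      ≤ ENNReal.ofReal (B₂ * Real.exp (-(β₂ / 2 * (K * Real.log K)))
        * ∑' k : ℕ, Real.exp (-(k : ℝ))) := by
  have hsum : Summable fun k : ℕ => Real.exp (-(k : ℝ)) := Real.summable_exp_neg_nat
  rw [polygonPrior_apply ρ α (measurableSet_param_fst fun k : ℕ+ => K < (k : ℝ))]
  have hterm : ∀ k : ℕ+, ρ k * dirichlet (fun j : Fin k => (α (bin k j)).toReal)
      {w | (⟨k, w⟩ : Param) ∈ {θ : Param | K < (θ.1 : ℝ)}}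
      ≤ ENNReal.ofReal (B₂ * Real.exp (-(β₂ / 2 * (K * Real.log K))) * Real.exp (-(k : ℝ))) := by
    intro k
    have := isProbabilityMeasure_dirichlet (hpos k)
    by_cases h : K < (k : ℝ)
    · calc _ ≤ ρ k * 1 := by gcongr; exact prob_le_one
        _ = ENNReal.ofReal (ρ k).toReal := by
            rw [mul_one, ENNReal.ofReal_toReal (ρ.apply_ne_top k)]
        _ ≤ _ := by
            apply ENNReal.ofReal_le_ofReal
            refine (hρ k).trans ?_
            rw [mul_assoc B₂, ← Real.exp_add]
            gcongr
            have h1 : Real.log K ≤ Real.log k := Real.log_le_log (by linarith) h.le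
            have h2 : 0 ≤ Real.log K := Real.log_nonneg hK
            have h3 : 2 * (k : ℝ) ≤ β₂ * Real.log K * k := by nlinarith
            have h4 : β₂ * (K * Real.log K) ≤ β₂ * (k * Real.log k) := by gcongr
            have h5 : β₂ * (k * Real.log K) ≤ β₂ * (k * Real.log k) := by gcongr
            nlinarith
    · have : {w : Fin k → ℝ | (⟨k, w⟩ : Param) ∈ {θ : Param | K < (θ.1 : ℝ)}} = ∅ :=
        eq_empty_of_forall_notMem fun _ => h
      rw [this, measure_empty, mul_zero]
      exact zero_le
  refine (ENNReal.tsum_le_tsum hterm).trans ?_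
  rw [← tsum_mul_left, ENNReal.ofReal_tsum_of_nonneg (fun k => by positivity) (hsum.mul_left _)]
  exact ENNReal.tsum_comp_le_tsum_of_injective PNat.coe_injective
    (fun k : ℕ => ENNReal.ofReal (B₂ * Real.exp (-(β₂ / 2 * (K * Real.log K)))
      * Real.exp (-(k : ℝ))))

theorem mul_dirichlet_le_polygonPrior (k : ℕ+) {S : Set Param} (hS : MeasurableSet S) :
    ρ k * dirichlet (fun j : Fin k => (α (bin k j)).toReal) {w | (⟨k, w⟩ : Param) ∈ S}
      ≤ polygonPrior ρ α S := by
  rw [polygonPrior_apply ρ α hS]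
  exact ENNReal.le_tsum k

end Prior

/-! ### Hellinger affinity and covering by boxes -/

theorem distL1_eq_lintegral (f g : ℝ → ℝ) :
    distL1 f g = ∫⁻ x, ENNReal.ofReal |f x - g x| ∂lam := by
  unfold distL1
  rw [eLpNorm_one_eq_lintegral_enorm]
  simp only [Real.enorm_eq_ofReal_abs]

/-- A linearized Cauchy–Schwarz bound between affinity and `L¹`-distance, from Young's inequality
for `|u - q| = |√u - √q| (√u + √q)`. It can be integrated pointwise, and `c` is chosen afterwards.
-/
theorem mul_sqrt_add_abs_sub_le {u q c : ℝ} (hu : 0 ≤ u) (hq : 0 ≤ q) (hc : 0 < c) :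
    c * √(u * q) + |u - q| ≤ (c / 2 + 1 / c) * (u + q) := by
  obtain ⟨a, ha, rfl⟩ : ∃ a, 0 ≤ a ∧ a ^ 2 = u := ⟨√u, Real.sqrt_nonneg _, Real.sq_sqrt hu⟩
  obtain ⟨b, hb, rfl⟩ : ∃ b, 0 ≤ b ∧ b ^ 2 = q := ⟨√q, Real.sqrt_nonneg _, Real.sq_sqrt hq⟩
  rw [← mul_pow, Real.sqrt_sq (by positivity), sq_sub_sq, abs_mul, abs_of_nonneg (add_nonneg ha hb)]
  have h1 : (a + b) * |a - b| ≤ c / 2 * (a - b) ^ 2 + 1 / (2 * c) * (a + b) ^ 2 := by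
    have : c / 2 * (a - b) ^ 2 + 1 / (2 * c) * (a + b) ^ 2 - (a + b) * |a - b|
        = (c * |a - b| - (a + b)) ^ 2 / (2 * c) := by
      rw [← sq_abs (a - b)]; field_simp; ring
    have h2 : 0 ≤ (c * |a - b| - (a + b)) ^ 2 / (2 * c) := by positivity
    linarith
  have h3 : 1 / (2 * c) * (a + b) ^ 2 ≤ 1 / c * (a ^ 2 + b ^ 2) := by
    rw [one_div_mul_eq_div, one_div_mul_eq_div, div_le_div_iff₀ (by positivity) hc]
    nlinarith [mul_nonneg hc.le (sq_nonneg (a - b))]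
  nlinarith

/-- The affinity of `u` and `q` is bounded in terms of their `L¹`-distance. -/
theorem lintegral_sqrt_mul_le {u q : ℝ → ℝ} (hu : Measurable u) (hq : Measurable q)
    (hu0 : ∀ x ∈ Icc (0 : ℝ) 1, 0 ≤ u x) (hq0 : IsDensity q) {τ d : ℝ} (hτ : 0 ≤ τ) (hτ1 : τ ≤ 1)
    (hu1 : ∫⁻ x, ENNReal.ofReal (u x) ∂lam ≤ ENNReal.ofReal (1 + τ)) (hd : 0 < d)
    (hdist : ENNReal.ofReal d ≤ distL1 u q) :
    ∫⁻ x, ENNReal.ofReal √(u x * q x) ∂lam ≤ ENNReal.ofReal ((2 + τ) / 2 - d ^ 2 / 12) := by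
  -- With this `c` the gain is `d / c = d²/6`, and the loss `(2 + τ) / c²` is at most `d²/12`.
  set c := 6 / d with hc
  have hc0 : 0 < c := by positivity
  have h : ENNReal.ofReal c * ∫⁻ x, ENNReal.ofReal √(u x * q x) ∂lam + distL1 u q
      ≤ ENNReal.ofReal (c / 2 + 1 / c) * (ENNReal.ofReal (1 + τ) + 1) := by
    rw [distL1_eq_lintegral, ← lintegral_const_mul _ (by fun_prop),
      ← lintegral_add_left (by fun_prop), ← hq0.2]
    refine le_trans ?_ (mul_le_mul_right (add_le_add_left hu1 _) _)
    rw [← lintegral_add_left (by fun_prop), ← lintegral_const_mul _ (by fun_prop)]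
    refine lintegral_mono_ae ?_
    filter_upwards [ae_lam_mem] with x hx
    rw [← ENNReal.ofReal_mul hc0.le, ← ENNReal.ofReal_add (by positivity) (abs_nonneg _),
      ← ENNReal.ofReal_add (hu0 x hx) (hq0.1 x hx), ← ENNReal.ofReal_mul (by positivity)]
    exact ENNReal.ofReal_le_ofReal (mul_sqrt_add_abs_sub_le (hu0 x hx) (hq0.1 x hx) hc0)
  rw [← ENNReal.ofReal_one, ← ENNReal.ofReal_add (by positivity) zero_le_one,
    ← ENNReal.ofReal_mul (by positivity)] at h
  replace h := (add_le_add_right hdist _).trans h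
  set A := ∫⁻ x, ENNReal.ofReal √(u x * q x) ∂lam
  have hAt : A ≠ ∞ := by
    intro hA
    rw [hA, ENNReal.mul_top (by simpa using hc0), top_add] at h
    exact absurd h (not_le.2 ENNReal.ofReal_lt_top)
  rw [← ENNReal.ofReal_toReal hAt] at h ⊢
  have hA0 : 0 ≤ A.toReal := ENNReal.toReal_nonneg
  rw [← ENNReal.ofReal_mul hc0.le, ← ENNReal.ofReal_add (by positivity) hd.le,
    ENNReal.ofReal_le_ofReal_iff (by positivity)] at h
  apply ENNReal.ofReal_le_ofReal
  have h2 : A.toReal ≤ ((c / 2 + 1 / c) * (1 + τ + 1) - d) / c := by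
    rw [le_div_iff₀ hc0]; linarith
  refine h2.trans ?_
  have : ((c / 2 + 1 / c) * (1 + τ + 1) - d) / c
      = (2 + τ) / 2 + d ^ 2 / 36 * (2 + τ) - d ^ 2 / 6 := by
    rw [hc]; field_simp; ring
  rw [this]
  nlinarith [mul_nonneg (sq_nonneg d) (sub_nonneg.2 hτ1)]

/-- The parameters in the simplex whose weights round down to `g j / N`. -/
def box (N : ℕ) (i : Σ k : ℕ+, (Fin k → Fin (N + 1))) : Set Param :=
  (fun w : Fin i.1 → ℝ => (⟨i.1, w⟩ : Param)) ''
    {w | w ∈ simplex i.1 ∧ ∀ j, ⌊(N : ℝ) * w j⌋₊ = i.2 j}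

/-- The upper polygon of a box. -/
noncomputable def boxUpper (N : ℕ) (i : Σ k : ℕ+, (Fin k → Fin (N + 1))) : ℝ → ℝ :=
  polygon i.1 fun j => ((i.2 j : ℕ) + 1) / (N : ℝ)

theorem measurableSet_box (N : ℕ) (i : Σ k : ℕ+, (Fin k → Fin (N + 1))) :
    MeasurableSet (box N i) := by
  refine (measurableEmbedding_param i.1).measurableSet_image' ?_
  have h : MeasurableSet {w : Fin i.1 → ℝ | ∀ j, ⌊(N : ℝ) * w j⌋₊ = i.2 j} := by
    have : {w : Fin i.1 → ℝ | ∀ j, ⌊(N : ℝ) * w j⌋₊ = i.2 j} = ⋂ j, {w : Fin i.1 → ℝ | ⌊(N : ℝ) * w j⌋₊ = i.2 j} := by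
      ext; simp
    rw [this]
    refine MeasurableSet.iInter fun j => ?_
    exact measurableSet_eq_fun (Nat.measurable_floor.comp (by fun_prop)) measurable_const
  exact (measurableSet_simplex _).inter h

theorem exists_mem_box {N : ℕ} {k : ℕ+} {w : Fin k → ℝ} (hw : w ∈ simplex k) :
    ∃ g : Fin k → Fin (N + 1), (⟨k, w⟩ : Param) ∈ box N ⟨k, g⟩ := by
  have hle : ∀ j, ⌊(N : ℝ) * w j⌋₊ < N + 1 := by
    intro j
    rw [Nat.lt_succ_iff]
    refine Nat.floor_le_of_le ?_
    have : w j ≤ 1 := by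
      rw [← hw.2]
      exact Finset.single_le_sum (fun i _ => hw.1 i) (Finset.mem_univ j)
    exact mul_le_of_le_one_right (Nat.cast_nonneg N) this
  exact ⟨fun j => ⟨⌊(N : ℝ) * w j⌋₊, hle j⟩, w, ⟨hw, fun j => rfl⟩, rfl⟩

theorem le_boxUpper {N : ℕ} (hN : 0 < N) {i : Σ k : ℕ+, (Fin k → Fin (N + 1))} {θ : Param}
    (hθ : θ ∈ box N i) {x : ℝ} (hx : x ∈ Icc (0 : ℝ) 1) : θ.density x ≤ boxUpper N i x := by
  obtain ⟨w, ⟨hw, hg⟩, rfl⟩ := hθ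
  refine polygon_mono (fun j => ?_) hx
  have hN' : (0 : ℝ) < N := by exact_mod_cast hN
  rw [le_div_iff₀ hN', ← hg j, mul_comm]
  exact (Nat.lt_floor_add_one _).le

theorem box_sum_le {N : ℕ} (hN : 0 < N) {i : Σ k : ℕ+, (Fin k → Fin (N + 1))} {w : Fin i.1 → ℝ}
    (hw : w ∈ simplex i.1) (hg : ∀ j, ⌊(N : ℝ) * w j⌋₊ = i.2 j) {τ : ℝ} (hτ : (i.1 : ℝ) ≤ τ * N) :
    ∑ j, ((i.2 j : ℕ) + 1) / (N : ℝ) ≤ 1 + τ := by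
  have hN' : (0 : ℝ) < N := by exact_mod_cast hN
  calc ∑ j, ((i.2 j : ℕ) + 1) / (N : ℝ) ≤ ∑ j, (w j + 1 / N) := by
        refine Finset.sum_le_sum fun j _ => ?_
        rw [add_div, ← hg j]
        gcongr
        rw [div_le_iff₀ hN', mul_comm]
        exact Nat.floor_le (mul_nonneg (hw.1 j) hN'.le)
    _ = 1 + i.1 / N := by
        rw [Finset.sum_add_distrib, hw.2, Finset.sum_const, Finset.card_univ, Fintype.card_fin,
          nsmul_eq_mul, mul_one_div]
    _ ≤ 1 + τ := by
        gcongr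
        rwa [div_le_iff₀ hN']

theorem distL1_triangle {f g h : ℝ → ℝ} (hf : Measurable f) (hg : Measurable g) :
    distL1 f h ≤ distL1 f g + distL1 g h := by
  rw [distL1_eq_lintegral, distL1_eq_lintegral, distL1_eq_lintegral,
    ← lintegral_add_left (by fun_prop)]
  refine lintegral_mono fun x => ?_
  rw [← ENNReal.ofReal_add (abs_nonneg _) (abs_nonneg _)]
  exact ENNReal.ofReal_le_ofReal (abs_sub_le _ _ _)

/-- The upper polygon dominates a density of its box and has mass at most `1 + τ`. It is therefore
within `τ` of that density, hence at distance at least `d - τ` from `f`. -/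
theorem boxUpper_affinity_le {f : ℝ → ℝ} (hf : Measurable f) (hd : IsDensity f) {N : ℕ}
    (hN : 0 < N) {i : Σ k : ℕ+, (Fin k → Fin (N + 1))} {τ d : ℝ} (hτ : 0 ≤ τ) (hτ1 : τ ≤ 1)
    (hτd : τ < d) (hk : (i.1 : ℝ) ≤ τ * N) {θ : Param} (hθ : θ ∈ box N i)
    (hdist : ENNReal.ofReal d < distL1 θ.density f) :
    ∫⁻ x, ENNReal.ofReal √(boxUpper N i x * f x) ∂lam
      ≤ ENNReal.ofReal ((2 + τ) / 2 - (d - τ) ^ 2 / 12) := by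
  have hle := fun x hx => le_boxUpper hN hθ (x := x) hx
  obtain ⟨w, ⟨hw, hg⟩, rfl⟩ := hθ
  have hsum := box_sum_le hN hw hg hk
  have hum : Measurable (boxUpper N i) := measurable_polygon_right _ _
  have hwm : Measurable (polygon i.1 w) := measurable_polygon_right _ _
  have hg0 : ∀ j, 0 ≤ ((i.2 j : ℕ) + 1) / (N : ℝ) := fun j => by positivity
  have hu1 : ∫⁻ x, ENNReal.ofReal (boxUpper N i x) ∂lam
      = ENNReal.ofReal (∑ j, ((i.2 j : ℕ) + 1) / (N : ℝ)) := lintegral_polygon i.1 hg0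
  have hw1 : ∫⁻ x, ENNReal.ofReal (polygon i.1 w x) ∂lam = 1 := by
    rw [lintegral_polygon i.1 hw.1, hw.2, ENNReal.ofReal_one]
  have hclose : distL1 (polygon i.1 w) (boxUpper N i) ≤ ENNReal.ofReal τ := by
    have h : distL1 (polygon i.1 w) (boxUpper N i) + 1 ≤ ENNReal.ofReal τ + 1 := by
      calc distL1 (polygon i.1 w) (boxUpper N i) + 1
          = ∫⁻ x, ENNReal.ofReal (boxUpper N i x) ∂lam := by
            rw [distL1_eq_lintegral, ← hw1, ← lintegral_add_left (by fun_prop)]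
            refine lintegral_congr_ae ?_
            filter_upwards [ae_lam_mem] with x hx
            have h1 : polygon i.1 w x ≤ boxUpper N i x := hle x hx
            rw [← ENNReal.ofReal_add (abs_nonneg _) (polygon_nonneg hw.1 hx), abs_sub_comm,
              abs_of_nonneg (sub_nonneg.2 h1), sub_add_cancel]
        _ ≤ ENNReal.ofReal (1 + τ) := by
            rw [hu1]; exact ENNReal.ofReal_le_ofReal hsum
        _ = _ := by rw [add_comm, ENNReal.ofReal_add hτ zero_le_one, ENNReal.ofReal_one]
    exact (ENNReal.add_le_add_iff_right ENNReal.one_ne_top).1 h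
  refine lintegral_sqrt_mul_le hum hf (fun x hx => polygon_nonneg hg0 hx) hd hτ hτ1
    (by rw [hu1]; exact ENNReal.ofReal_le_ofReal hsum) (sub_pos.2 hτd) ?_
  have h1 : ENNReal.ofReal d ≤ ENNReal.ofReal τ + distL1 (boxUpper N i) f :=
    hdist.le.trans ((distL1_triangle hwm hum).trans (add_le_add_left hclose _))
  rw [ENNReal.ofReal_sub _ hτ]
  exact tsub_le_iff_left.2 h1

-- The general bound applied to the cover of the far set by `{k > K}` and at most `K (N+1)^K` boxes.
open Classical in
theorem lintegral_postDist_far_le {ρ : PMF ℕ+} {α : Measure ℝ}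
    (hpos : ∀ (k : ℕ+) (j : Fin k), 0 < (α (bin k j)).toReal)
    {f : ℝ → ℝ} (hf : Measurable f) (hd : IsDensity f) {N : ℕ} (hN : 0 < N) {K : ℕ+}
    {τ d : ℝ} (hτ : 0 ≤ τ) (hτ1 : τ ≤ 1) (hτd : τ < d) (hK : (K : ℝ) ≤ τ * N) {s c : ℝ≥0∞}
    (hB0 : polygonPrior ρ α (chiSqBall f s) ≠ 0) (hc : c ≠ 0) (hc' : c ≠ ∞) (n : ℕ) :
    ∫⁻ X, postDist (polygonPrior ρ α) X {θ | ENNReal.ofReal d < distL1 θ.density f}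
        ∂(sampleLaw f n)
      ≤ c⁻¹ * s ^ n
        + c / polygonPrior ρ α (chiSqBall f s) * polygonPrior ρ α {θ | (K : ℝ) < (θ.1 : ℝ)}
        + K * (N + 1) ^ (K : ℕ) * ((c / polygonPrior ρ α (chiSqBall f s)) ^ (1 / 2 : ℝ)
          * ENNReal.ofReal ((2 + τ) / 2 - (d - τ) ^ 2 / 12) ^ n) := by
  have := isProbabilityMeasure_polygonPrior (ρ := ρ) hpos
  set π := polygonPrior ρ α
  have hsim := ae_polygonPrior_mem_simplex (ρ := ρ) hpos
  -- Parameters off the simplex lie in no box; they form a null set of the prior and are put into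
  -- `V`.
  set V : Set Param := {θ | (K : ℝ) < (θ.1 : ℝ)} ∪ {θ | θ.2 ∈ simplex θ.1}ᶜ with hVdef
  have hVm : MeasurableSet V :=
    (measurableSet_param_fst fun k : ℕ+ => (K : ℝ) < (k : ℝ)).union
      measurableSet_simplex_param.compl
  have hVle : π V ≤ π {θ | (K : ℝ) < (θ.1 : ℝ)} := by
    refine (measure_union_le _ _).trans ?_
    rw [show π {θ | θ.2 ∈ simplex θ.1}ᶜ = 0 from hsim, add_zero]
  -- Only boxes that contain a far density are kept, since the affinity bound needs such a point.
  set I : Finset (Σ k : ℕ+, (Fin k → Fin (N + 1))) :=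
    (Finset.Icc 1 K).sigma fun k => Finset.univ.filter fun g =>
      ∃ θ ∈ box N ⟨k, g⟩, ENNReal.ofReal d < distL1 θ.density f with hI
  have hcover : {θ : Param | ENNReal.ofReal d < distL1 θ.density f} ⊆ V ∪ ⋃ i ∈ I, box N i := by
    rintro ⟨k, w⟩ hθ
    by_cases hV : (⟨k, w⟩ : Param) ∈ V
    · exact Or.inl hV
    · right
      simp only [hVdef, mem_union, mem_compl_iff, not_or, not_not] at hV
      obtain ⟨hk, hw⟩ := hV
      obtain ⟨g, hg⟩ := exists_mem_box (N := N) hw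
      refine mem_iUnion₂.2 ⟨⟨k, g⟩, ?_, hg⟩
      rw [hI, Finset.mem_sigma, Finset.mem_Icc, Finset.mem_filter]
      refine ⟨⟨one_le, ?_⟩, Finset.mem_univ _, _, hg, hθ⟩
      have h1 : (k : ℝ) ≤ K := not_lt.1 hk
      exact_mod_cast h1
  have hmain := lintegral_postDist_le hf hd π (measurableSet_chiSqBall hf s) hVm (s := s)
    (fun θ hθ => hθ) hB0 hc hc' (by
      filter_upwards [hsim] with θ hθ
      have h1 := lintegral_polygon θ.1 hθ.1
      rw [hθ.2, ENNReal.ofReal_one] at h1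
      exact h1.le) I (fun i _ => measurableSet_box N i)
    (fun i _ => (measurable_polygon_right _ _ : Measurable (boxUpper N i)))
    (fun i _ θ hθ x hx => le_boxUpper hN hθ hx) hcover n
  refine hmain.trans (add_le_add (by gcongr) ?_)
  have haff : ∀ i ∈ I, ∫⁻ x, ENNReal.ofReal √(boxUpper N i x * f x) ∂lam
      ≤ ENNReal.ofReal ((2 + τ) / 2 - (d - τ) ^ 2 / 12) := by
    rintro ⟨k, g⟩ hi
    rw [hI, Finset.mem_sigma, Finset.mem_Icc, Finset.mem_filter] at hi
    obtain ⟨⟨-, hk⟩, -, θ, hθ, hθd⟩ := hi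
    refine boxUpper_affinity_le hf hd hN hτ hτ1 hτd (le_trans ?_ hK) hθ hθd
    exact_mod_cast hk
  have hcard : I.card ≤ K * (N + 1) ^ (K : ℕ) := by
    rw [hI, Finset.card_sigma]
    calc _ ≤ ∑ k ∈ Finset.Icc (1 : ℕ+) K, (N + 1) ^ (K : ℕ) := by
          refine Finset.sum_le_sum fun k hk => ?_
          refine (Finset.card_filter_le _ _).trans ?_
          rw [Finset.card_univ, Fintype.card_fun, Fintype.card_fin, Fintype.card_fin]
          exact Nat.pow_le_pow_right (Nat.succ_pos N) (Finset.mem_Icc.1 hk).2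
      _ = _ := by rw [Finset.sum_const, PNat.card_Icc]; simp
  calc _ ≤ ∑ _ ∈ I, (c / π (chiSqBall f s)) ^ (1 / 2 : ℝ)
          * ENNReal.ofReal ((2 + τ) / 2 - (d - τ) ^ 2 / 12) ^ n := by
        refine Finset.sum_le_sum fun i hi => ?_
        gcongr
        exact haff i hi
    _ ≤ _ := by
        rw [Finset.sum_const, nsmul_eq_mul]
        gcongr
        exact_mod_cast hcard

/-! ### The contraction rate -/

/-- The optimal number of bins `(n / log n)^{1/(2β+1)}`, up to rounding. -/
noncomputable def optBins (β : ℝ) (n : ℕ) : ℝ := ((n : ℝ) / Real.log n) ^ (1 / (2 * β + 1))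

theorem eventually_le_log (Q : ℝ) : ∀ᶠ n : ℕ in atTop, Q ≤ Real.log n :=
  (Real.tendsto_log_atTop.comp tendsto_natCast_atTop_atTop).eventually_ge_atTop Q

theorem log_le_half {l : ℝ} (hl : 0 < l) : Real.log l ≤ l / 2 := by
  have h := Real.log_le_sub_one_of_pos (half_pos hl)
  rw [Real.log_div hl.ne' two_ne_zero] at h
  linarith [Real.log_two_lt_d9]

section Rate

variable {β : ℝ} {n : ℕ}

theorem one_le_div_log (hn : 1 ≤ Real.log n) : 1 ≤ (n : ℝ) / Real.log n := by
  have hn0 : (0 : ℝ) < n := by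
    rcases Nat.eq_zero_or_pos n with rfl | h
    · norm_num at hn
    · exact_mod_cast h
  rw [one_le_div (by linarith)]
  linarith [Real.log_le_sub_one_of_pos hn0]

theorem one_le_optBins (hβ : 0 < β) (hn : 1 ≤ Real.log n) : 1 ≤ optBins β n :=
  Real.one_le_rpow (one_le_div_log hn) (by positivity)

theorem rate_eq_optBins (hβ : 0 < β) (hn : 1 ≤ Real.log n) :
    rate β n = optBins β n ^ (-β) := by
  have h2 : 0 < 2 * β + 1 := by positivity
  have hl : 0 < Real.log n := by linarith
  have h1 := one_le_div_log hn
  rw [rate, optBins, ← Real.rpow_mul (by linarith),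
    show 1 / (2 * β + 1) * -β = -(β / (2 * β + 1)) by ring,
    Real.div_rpow (Nat.cast_nonneg n) hl.le, Real.rpow_neg hl.le, div_inv_eq_mul]

theorem optBins_rpow (hβ : 0 < β) (hn : 1 ≤ Real.log n) :
    optBins β n ^ (2 * β + 1) * Real.log n = n := by
  have h2 : 0 < 2 * β + 1 := by positivity
  have h1 := one_le_div_log hn
  have hl : Real.log n ≠ 0 := by linarith
  rw [optBins, ← Real.rpow_mul (by linarith), one_div_mul_cancel h2.ne', Real.rpow_one,
    div_mul_cancel₀ _ hl]

/-- The balance that determines the rate: `n` times the squared approximation error equals the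
complexity `m log n` of `m` bins. -/
theorem mul_rate_sq (hβ : 0 < β) (hn : 1 ≤ Real.log n) :
    n * rate β n ^ 2 = optBins β n * Real.log n := by
  have hm : 0 < optBins β n := by linarith [one_le_optBins hβ hn]
  rw [rate_eq_optBins hβ hn, ← Real.rpow_natCast, ← Real.rpow_mul hm.le]
  nth_rw 1 [← optBins_rpow hβ hn]
  rw [mul_right_comm, ← Real.rpow_add hm, show 2 * β + 1 + -β * ((2 : ℕ) : ℝ) = 1 by
    push_cast; ring, Real.rpow_one]

theorem optBins_mul_log_le (hβ : 0 < β) (hn : 1 ≤ Real.log n) :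
    optBins β n * Real.log n ≤ n := by
  have hm := one_le_optBins hβ hn
  conv_rhs => rw [← optBins_rpow hβ hn]
  gcongr
  conv_lhs => rw [← Real.rpow_one (optBins β n)]
  exact Real.rpow_le_rpow_of_exponent_le hm (by linarith)

/-- The number of bins grows polynomially in `n`, so the prior tail `exp(-const · K log K)` is of
the same exponential order as `exp(-const · m log n)`. -/
theorem log_optBins_ge (hβ : 0 < β) (hn : 1 ≤ Real.log n) :
    1 / (2 * (2 * β + 1)) * Real.log n ≤ Real.log (optBins β n) := by
  have h1 := one_le_div_log hn
  have hl : 0 < Real.log n := by linarith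
  have hn0 : (n : ℝ) ≠ 0 := by
    rintro h; rw [h, zero_div] at h1; norm_num at h1
  rw [optBins, Real.log_rpow (by linarith), Real.log_div hn0 hl.ne']
  have h2 := log_le_half hl
  calc _ = 1 / (2 * β + 1) * (Real.log n / 2) := by field_simp
    _ ≤ _ := by gcongr; linarith

theorem tendsto_rate (hβ : 0 < β) : Tendsto (rate β) atTop (𝓝 0) := by
  have h1 : Tendsto (fun n : ℕ => Real.log (optBins β n)) atTop atTop := by
    refine tendsto_atTop_mono' _ ((eventually_le_log 1).mono fun n hn => log_optBins_ge hβ hn) ?_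
    exact (Real.tendsto_log_atTop.comp tendsto_natCast_atTop_atTop).const_mul_atTop (by positivity)
  have h2 : Tendsto (fun n : ℕ => Real.exp (-(β * Real.log (optBins β n)))) atTop (𝓝 0) :=
    Real.tendsto_exp_neg_atTop_nhds_zero.comp (h1.const_mul_atTop hβ)
  refine h2.congr' ?_
  filter_upwards [eventually_le_log 1] with n hn
  have hm : 0 < optBins β n := by linarith [one_le_optBins hβ hn]
  rw [rate_eq_optBins hβ hn, Real.rpow_def_of_pos hm]
  congr 1
  ring

theorem rate_pos (hβ : 0 < β) (hn : 1 ≤ Real.log n) : 0 < rate β n := by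
  rw [rate_eq_optBins hβ hn]
  have hm : 0 < optBins β n := by linarith [one_le_optBins hβ hn]
  positivity

theorem rate_le_one (hβ : 0 < β) (hn : 1 ≤ Real.log n) : rate β n ≤ 1 := by
  rw [rate_eq_optBins hβ hn]
  exact Real.rpow_le_one_of_one_le_of_nonpos (one_le_optBins hβ hn) (by linarith)

/-- Holds because `exp(-m log n) ≤ 1/n` and `n ε² = m log n ≥ 1`. It converts exponential bounds
into the squared rate required for the risk. -/
theorem exp_neg_mul_rate_sq_le (hβ : 0 < β) (hn : 1 ≤ Real.log n) :
    Real.exp (-(optBins β n * Real.log n)) ≤ rate β n ^ 2 := by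
  have hm := one_le_optBins hβ hn
  have hn0 : (0 : ℝ) < n := by
    have := optBins_mul_log_le hβ hn
    nlinarith
  have h1 : Real.exp (-(optBins β n * Real.log n)) ≤ Real.exp (-Real.log n) := by
    apply Real.exp_le_exp.2
    nlinarith
  rw [Real.exp_neg (Real.log n), Real.exp_log hn0] at h1
  refine h1.trans ?_
  rw [inv_le_iff_one_le_mul₀ hn0, mul_comm, mul_rate_sq hβ hn]
  nlinarith

end Rate

theorem ceil_le_two_mul {x : ℝ} (hx : 1 ≤ x) : (⌈x⌉₊ : ℝ) ≤ 2 * x := by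
  have := Nat.ceil_lt_add_one (show 0 ≤ x by linarith)
  linarith

/-- Prior mass of a chi-square ball of squared radius of the order `rate β n ^ 2`. -/
theorem polygonPrior_chiSqBall_ge {ρ : PMF ℕ+} {α : Measure ℝ} {f : ℝ → ℝ} (hf : Measurable f)
    {B₁ β₁ C₂ D β : ℝ} (hB₁ : 0 < B₁) (hβ₁ : 0 < β₁) (hC₂ : 0 < C₂) (hD : 0 < D) (hβ : 0 < β)
    (hρ : ∀ k : ℕ+, B₁ * Real.exp (-β₁ * (k : ℝ) * Real.log (k : ℝ)) ≤ (ρ k).toReal)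
    (hdir : ∀ k : ℕ+, ENNReal.ofReal (Real.exp (-D * (k * (1 + Real.log k))))
      ≤ dirichlet (fun j : Fin k => (α (bin k j)).toReal)
        {w | (⟨k, w⟩ : Param) ∈ chiSqBall f (1 + ENNReal.ofReal (C₂ * ((k : ℝ) ^ (-β)) ^ 2))})
    {n : ℕ} (hn : 2 ≤ Real.log n) :
    ENNReal.ofReal (B₁ * Real.exp (-((2 * β₁ + 4 * D) * (optBins β n * Real.log n))))
      ≤ polygonPrior ρ α (chiSqBall f (1 + ENNReal.ofReal (C₂ * rate β n ^ 2))) := by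
  have hn1 : 1 ≤ Real.log n := by linarith
  have hm := one_le_optBins hβ hn1
  have hmn := optBins_mul_log_le hβ hn1
  set m := optBins β n with hmdef
  set l := Real.log n with hldef
  have hkpos : 0 < ⌈m⌉₊ := Nat.ceil_pos.2 (by linarith)
  -- One value of `k` suffices: `k ≥ m` makes the radius at most the rate, and `k ≤ 2m ≤ n` bounds
  -- the cost.
  obtain ⟨k, hk⟩ : ∃ k : ℕ+, (k : ℕ) = ⌈m⌉₊ := ⟨⟨_, hkpos⟩, rfl⟩
  have hkm : m ≤ k := by rw [hk]; exact Nat.le_ceil m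
  have hk2 : (k : ℝ) ≤ 2 * m := by rw [hk]; exact ceil_le_two_mul hm
  have hk0 : (0 : ℝ) < k := by linarith
  have hkn : (k : ℝ) ≤ n := by nlinarith
  have hlogk : Real.log k ≤ l := Real.log_le_log hk0 hkn
  have hlogk0 : 0 ≤ Real.log k := Real.log_nonneg (by linarith)
  have hball : chiSqBall f (1 + ENNReal.ofReal (C₂ * ((k : ℝ) ^ (-β)) ^ 2))
      ⊆ chiSqBall f (1 + ENNReal.ofReal (C₂ * rate β n ^ 2)) := by
    refine chiSqBall_subset f ?_
    rw [rate_eq_optBins hβ hn1, ← hmdef]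
    have : (k : ℝ) ^ (-β) ≤ m ^ (-β) :=
      Real.rpow_le_rpow_of_nonpos (by linarith) hkm (by linarith)
    gcongr
  refine le_trans ?_ ((mul_dirichlet_le_polygonPrior k (measurableSet_chiSqBall hf _)).trans
    (measure_mono hball))
  refine le_trans ?_ (mul_le_mul' (le_refl (ρ k)) (hdir k))
  rw [← ENNReal.ofReal_toReal (ρ.apply_ne_top k), ← ENNReal.ofReal_mul ENNReal.toReal_nonneg]
  apply ENNReal.ofReal_le_ofReal
  refine le_trans ?_ (mul_le_mul_of_nonneg_right (hρ k) (Real.exp_pos _).le)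
  rw [mul_assoc, ← Real.exp_add]
  gcongr
  have h1 : (k : ℝ) * Real.log k ≤ 2 * m * l := by gcongr
  have h2 : (k : ℝ) * (1 + Real.log k) ≤ 2 * m * (2 * l) := by
    gcongr
    linarith
  nlinarith [mul_le_mul_of_nonneg_left h1 hβ₁.le, mul_le_mul_of_nonneg_left h2 hD.le]

/-- The affinity bound with `d = M ε` and `τ = ε²`: here `d - τ ≥ (M - 1) ε` as `ε ≤ 1`, and `1 + x
≤ exp x` does the rest. -/
theorem affinity_pow_le {M ε T : ℝ} (hM : 1 ≤ M) (hε : 0 ≤ ε) (hε1 : ε ≤ 1) {n : ℕ}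
    (hT : n * ε ^ 2 = T) :
    ENNReal.ofReal ((2 + ε ^ 2) / 2 - (M * ε - ε ^ 2) ^ 2 / 12) ^ n
      ≤ ENNReal.ofReal (Real.exp ((1 / 2 - (M - 1) ^ 2 / 12) * T)) := by
  rw [← hT, mul_left_comm, Real.exp_nat_mul, ENNReal.ofReal_pow (Real.exp_pos _).le]
  gcongr
  refine le_trans ?_ (Real.add_one_le_exp _)
  have h1 : (M - 1) * ε ≤ M * ε - ε ^ 2 := by nlinarith
  have h2 : ((M - 1) * ε) ^ 2 ≤ (M * ε - ε ^ 2) ^ 2 :=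
    pow_le_pow_left₀ (mul_nonneg (by linarith) hε) h1 2
  nlinarith

/-- With `T = n ε²`, the three terms of `lintegral_postDist_far_le` are each made at most a constant
times `exp(-T)`, by choosing first the evidence level, then the cutoff `K`, then `M`. -/
theorem exists_expected_posterior_le {ρ : PMF ℕ+} {B₁ B₂ β₁ β₂ : ℝ} (hB₁ : 0 < B₁)
    (hB₂ : 0 < B₂) (hβ₁ : 0 < β₁) (hβ₂ : 0 < β₂)
    (hρ : ∀ k : ℕ+, B₁ * Real.exp (-β₁ * (k : ℝ) * Real.log (k : ℝ)) ≤ (ρ k).toReal ∧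
      (ρ k).toReal ≤ B₂ * Real.exp (-β₂ * (k : ℝ) * Real.log (k : ℝ)))
    {α : Measure ℝ} (hpos : ∀ (k : ℕ+) (j : Fin k), 0 < (α (bin k j)).toReal)
    {f : ℝ → ℝ} (hf : Measurable f) (hd : IsDensity f) {β C₂ D : ℝ}
    (hβ : 0 < β) (hC₂ : 0 < C₂) (hD : 0 < D)
    (hdir : ∀ k : ℕ+, ENNReal.ofReal (Real.exp (-D * (k * (1 + Real.log k))))
      ≤ dirichlet (fun j : Fin k => (α (bin k j)).toReal)
        {w | (⟨k, w⟩ : Param) ∈ chiSqBall f (1 + ENNReal.ofReal (C₂ * ((k : ℝ) ^ (-β)) ^ 2))}) :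
    ∃ M₀ C : ℝ, 0 < M₀ ∧ 0 < C ∧ ∀ M : ℝ, M₀ ≤ M → ∀ᶠ n : ℕ in atTop,
      ∫⁻ X, postDist (polygonPrior ρ α) X
        {θ | ENNReal.ofReal (M * rate β n) < distL1 θ.density f} ∂(sampleLaw f n)
        ≤ ENNReal.ofReal (C * rate β n ^ 2) := by
  -- The exponent in `c / π(B) ≤ B₁⁻¹ exp(a T)`: `C₂ + 1` comes from `c = exp((C₂+1) T)`, the rest
  -- from the prior mass of the ball.
  set a := C₂ + 1 + (2 * β₁ + 4 * D) with ha
  set c' := 1 / (2 * (2 * β + 1)) with hc'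
  have hc'0 : 0 < c' := by positivity
  -- Chosen so that with `K ≥ L m` the prior tail `exp(-(β₂/2) K log K)` beats `exp(a T)` by a
  -- further `exp(-T)`.
  set L := max 1 (2 * (a + 1) / (β₂ * c')) with hL
  have hL1 : 1 ≤ L := le_max_left _ _
  have hLa : a + 1 ≤ β₂ / 2 * c' * L := by
    have h : 2 * (a + 1) / (β₂ * c') ≤ L := le_max_right _ _
    rw [div_le_iff₀ (by positivity)] at h
    linarith
  set S₀ := ∑' k : ℕ, Real.exp (-(k : ℝ)) with hS₀
  have hS₀0 : 0 ≤ S₀ := tsum_nonneg fun k => (Real.exp_pos _).le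
  -- The affinity gain `(M-1)²/12` must pay for `K` (`1`), the boxes per `k` (`6L`), the root of the
  -- evidence factor (`a/2`), the excess mass of the upper polygons (`1/2`) and the final `exp(-T)`
  -- (`1`).
  set Q := 12 * (6 * L + a / 2 + 5 / 2) with hQ
  have ha0 : 0 < a := by positivity
  have hQ1 : 1 ≤ Q := by rw [hQ]; linarith
  refine ⟨1 + Q, 1 + B₁⁻¹ * (B₂ * S₀) + (B₁⁻¹) ^ (1 / 2 : ℝ), by linarith, by positivity,
    fun M hM => ?_⟩
  filter_upwards [eventually_le_log 2, eventually_le_log (2 * L), eventually_le_log (2 / (β₂ * c'))]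
    with n hn hnL hnβ
  have hn1 : 1 ≤ Real.log n := by linarith
  have hm := one_le_optBins hβ hn1
  have hmn := optBins_mul_log_le hβ hn1
  have hlm := log_optBins_ge hβ hn1
  have hε := rate_pos hβ hn1
  have hε1 := rate_le_one hβ hn1
  have hεT := mul_rate_sq hβ hn1
  have hexp := exp_neg_mul_rate_sq_le hβ hn1
  have hpri := polygonPrior_chiSqBall_ge hf hB₁ hβ₁ hC₂ hD hβ (fun k => (hρ k).1) hdir hn
  set m := optBins β n
  set l := Real.log n
  set ε := rate β n
  set T := m * l with hT
  have hT1 : l ≤ T := le_mul_of_one_le_left (by linarith) hm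
  have hn0 : (0 : ℝ) < n := by linarith
  have hLm : 1 ≤ L * m := by nlinarith
  have hKpos : 0 < ⌈L * m⌉₊ := Nat.ceil_pos.2 (by linarith)
  obtain ⟨K, hK⟩ : ∃ K : ℕ+, (K : ℕ) = ⌈L * m⌉₊ := ⟨⟨_, hKpos⟩, rfl⟩
  have hKm : L * m ≤ K := by rw [hK]; exact Nat.le_ceil _
  have hK2 : (K : ℝ) ≤ 2 * (L * m) := by rw [hK]; exact ceil_le_two_mul hLm
  have hLml : 2 * L * m ≤ l * m := mul_le_mul_of_nonneg_right hnL (by linarith)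
  have hKn : (K : ℝ) ≤ n := by linarith [mul_comm m l]
  have hKm' : m ≤ K := (le_mul_of_one_le_left (by linarith) hL1).trans hKm
  have hlogK : c' * l ≤ Real.log K := hlm.trans (Real.log_le_log (by linarith) hKm')
  have hprob := isProbabilityMeasure_polygonPrior (ρ := ρ) hpos
  have hN : 0 < n ^ 2 := by
    have : 0 < n := by exact_mod_cast hn0
    positivity
  -- The grid `N = n²` is fine enough for `τ = ε²`, since `ε² n² = n T ≥ n ≥ K`, yet `log N` is
  -- still of order `log n`.
  have hτN : (K : ℝ) ≤ ε ^ 2 * ((n ^ 2 : ℕ) : ℝ) := by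
    push_cast
    have : ε ^ 2 * (n : ℝ) ^ 2 = n * T := by rw [← hεT]; ring
    rw [this]
    exact hKn.trans (le_mul_of_one_le_right hn0.le (by linarith))
  have hMε : ε ^ 2 < M * ε := by
    rw [sq]
    exact mul_lt_mul_of_pos_right (by linarith) hε
  set πB := polygonPrior ρ α (chiSqBall f (1 + ENNReal.ofReal (C₂ * ε ^ 2)))
  have hπB0 : πB ≠ 0 := by
    refine ((ENNReal.ofReal_pos.2 ?_).trans_le hpri).ne'
    positivity
  have hc0 : ENNReal.ofReal (Real.exp ((C₂ + 1) * T)) ≠ 0 := by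
    rw [Ne, ENNReal.ofReal_eq_zero, not_le]
    positivity
  have hmain := lintegral_postDist_far_le hpos hf hd hN (sq_nonneg ε)
    (pow_le_one₀ hε.le hε1) hMε hτN hπB0 hc0 ENNReal.ofReal_ne_top n
  refine hmain.trans ?_
  have hfirst : (ENNReal.ofReal (Real.exp ((C₂ + 1) * T)))⁻¹
      * (1 + ENNReal.ofReal (C₂ * ε ^ 2)) ^ n ≤ ENNReal.ofReal (Real.exp (-T)) := by
    have h1 : (1 + ENNReal.ofReal (C₂ * ε ^ 2)) ^ n ≤ ENNReal.ofReal (Real.exp (C₂ * T)) := by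
      rw [← hεT, mul_left_comm, Real.exp_nat_mul, ENNReal.ofReal_pow (Real.exp_pos _).le]
      gcongr
      rw [← ENNReal.ofReal_one, ← ENNReal.ofReal_add zero_le_one (by positivity), add_comm]
      exact ENNReal.ofReal_le_ofReal (Real.add_one_le_exp _)
    refine (mul_le_mul' le_rfl h1).trans (le_of_eq ?_)
    rw [← ENNReal.ofReal_inv_of_pos (Real.exp_pos _), ← ENNReal.ofReal_mul (by positivity),
      ← Real.exp_neg, ← Real.exp_add]
    congr 2
    ring
  have hratio : ENNReal.ofReal (Real.exp ((C₂ + 1) * T)) / πB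
      ≤ ENNReal.ofReal (B₁⁻¹ * Real.exp (a * T)) := by
    refine (ENNReal.div_le_div_left hpri _).trans (le_of_eq ?_)
    rw [← ENNReal.ofReal_div_of_pos (by positivity)]
    congr 1
    rw [div_eq_mul_inv, mul_inv, ← Real.exp_neg, neg_neg, mul_left_comm, ← Real.exp_add, ha]
    congr 2
    ring
  have hsecond : ENNReal.ofReal (Real.exp ((C₂ + 1) * T)) / πB
      * polygonPrior ρ α {θ | (K : ℝ) < (θ.1 : ℝ)}
      ≤ ENNReal.ofReal (B₁⁻¹ * (B₂ * S₀) * Real.exp (-T)) := by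
    have hK1 : (1 : ℝ) ≤ K := by linarith
    have h2 : 2 ≤ β₂ * Real.log K := by
      rw [div_le_iff₀ (by positivity)] at hnβ
      have := mul_le_mul_of_nonneg_left hlogK hβ₂.le
      linarith
    refine (mul_le_mul' hratio
      (polygonPrior_fst_gt_le hB₂ hβ₂ (fun k => (hρ k).2) hpos hK1 h2)).trans ?_
    rw [← ENNReal.ofReal_mul (by positivity)]
    apply ENNReal.ofReal_le_ofReal
    calc B₁⁻¹ * Real.exp (a * T) * (B₂ * Real.exp (-(β₂ / 2 * (K * Real.log K))) * S₀)
        = B₁⁻¹ * (B₂ * S₀) * Real.exp (a * T + -(β₂ / 2 * (K * Real.log K))) := by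
          rw [Real.exp_add]; ring
      _ ≤ _ := by
          gcongr
          have h3 : L * m * (c' * l) ≤ K * Real.log K := by gcongr
          have h4 : (a + 1) * T ≤ β₂ / 2 * c' * L * T := by gcongr
          have h5 := mul_le_mul_of_nonneg_left h3 (show 0 ≤ β₂ / 2 by positivity)
          have h6 : β₂ / 2 * (L * m * (c' * l)) = β₂ / 2 * c' * L * T := by rw [hT]; ring
          linarith
  have hthird : (K : ℝ≥0∞) * (((n ^ 2 : ℕ) : ℝ≥0∞) + 1) ^ (K : ℕ)
      * ((ENNReal.ofReal (Real.exp ((C₂ + 1) * T)) / πB) ^ (1 / 2 : ℝ)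
        * ENNReal.ofReal ((2 + ε ^ 2) / 2 - (M * ε - ε ^ 2) ^ 2 / 12) ^ n)
      ≤ ENNReal.ofReal ((B₁⁻¹) ^ (1 / 2 : ℝ) * Real.exp (-T)) := by
    have h1 : (K : ℝ≥0∞) ≤ ENNReal.ofReal (Real.exp T) := by
      rw [← ENNReal.ofReal_natCast]
      apply ENNReal.ofReal_le_ofReal
      refine hKn.trans ?_
      rw [← Real.exp_log hn0]
      exact Real.exp_le_exp.2 hT1
    have h2 : (((n ^ 2 : ℕ) : ℝ≥0∞) + 1) ^ (K : ℕ) ≤ ENNReal.ofReal (Real.exp (6 * L * T)) := by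
      have h3 : ((n ^ 2 : ℕ) : ℝ≥0∞) + 1 ≤ ENNReal.ofReal (Real.exp (3 * l)) := by
        rw [← ENNReal.ofReal_natCast, ← ENNReal.ofReal_one,
          ← ENNReal.ofReal_add (Nat.cast_nonneg _) zero_le_one]
        apply ENNReal.ofReal_le_ofReal
        have : Real.exp (3 * l) = (n : ℝ) ^ 3 := by
          have := Real.exp_nat_mul l 3
          rw [Real.exp_log hn0] at this
          exact_mod_cast this
        rw [this]
        push_cast
        have hn2 : (2 : ℝ) ≤ n := by linarith
        have h6 : (2 : ℝ) * n ^ 2 ≤ n * n ^ 2 := by gcongr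
        have h7 : (1 : ℝ) ≤ n ^ 2 := one_le_pow₀ (by linarith)
        linarith [show (n : ℝ) ^ 3 = n * n ^ 2 by ring]
      refine (pow_le_pow_left₀ zero_le h3 _).trans ?_
      rw [← ENNReal.ofReal_pow (Real.exp_pos _).le, ← Real.exp_nat_mul]
      apply ENNReal.ofReal_le_ofReal
      apply Real.exp_le_exp.2
      have h6 : (K : ℝ) * (3 * l) ≤ 2 * (L * m) * (3 * l) :=
        mul_le_mul_of_nonneg_right hK2 (by linarith)
      have h7 : 2 * (L * m) * (3 * l) = 6 * L * T := by rw [hT]; ring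
      linarith
    have h4 : (ENNReal.ofReal (Real.exp ((C₂ + 1) * T)) / πB) ^ (1 / 2 : ℝ)
        ≤ ENNReal.ofReal ((B₁⁻¹) ^ (1 / 2 : ℝ) * Real.exp (a * T / 2)) := by
      refine (ENNReal.rpow_le_rpow hratio (by norm_num)).trans (le_of_eq ?_)
      rw [ENNReal.ofReal_rpow_of_nonneg (by positivity) (by norm_num),
        Real.mul_rpow (by positivity) (by positivity), ← Real.exp_mul]
      congr 3
      ring
    have h5 := affinity_pow_le (M := M) (by linarith) hε.le hε1 hεT
    refine (mul_le_mul' (mul_le_mul' h1 h2) (mul_le_mul' h4 h5)).trans ?_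
    rw [← ENNReal.ofReal_mul (by positivity), ← ENNReal.ofReal_mul (by positivity),
      ← ENNReal.ofReal_mul (by positivity)]
    apply ENNReal.ofReal_le_ofReal
    rw [mul_assoc ((B₁⁻¹) ^ (1 / 2 : ℝ)), mul_left_comm, ← Real.exp_add, ← Real.exp_add,
      ← Real.exp_add]
    gcongr
    have hM2 : Q ≤ (M - 1) ^ 2 := by nlinarith
    have hT0 : 0 ≤ T := by linarith
    have : T + 6 * L * T + (a * T / 2 + (1 / 2 - (M - 1) ^ 2 / 12) * T)
        = (1 + 6 * L + a / 2 + 1 / 2 - (M - 1) ^ 2 / 12) * T := by ring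
    rw [this]
    have h6 : 1 + 6 * L + a / 2 + 1 / 2 - (M - 1) ^ 2 / 12 ≤ -1 := by linarith
    have h7 := mul_le_mul_of_nonneg_right h6 hT0
    linarith
  refine (add_le_add (add_le_add hfirst hsecond) hthird).trans ?_
  rw [← ENNReal.ofReal_add (by positivity) (by positivity),
    ← ENNReal.ofReal_add (by positivity) (by positivity)]
  apply ENNReal.ofReal_le_ofReal
  calc _ = (1 + B₁⁻¹ * (B₂ * S₀) + (B₁⁻¹) ^ (1 / 2 : ℝ)) * Real.exp (-T) := by ring
    _ ≤ _ := by gcongr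

/-! ### The Bayes estimator -/

/-- The posterior is normalized when the evidence is finite and nonzero. It is a.s. finite because
its mean is at most one. Its vanishing lies in every event `{c · evidence < π(B)}`, of probability
at most `s ^ n / c`, and `c → ∞`. -/
theorem ae_isProbabilityMeasure_postDist {f : ℝ → ℝ} (hf : Measurable f) (hd : IsDensity f)
    (π : Measure Param) [IsProbabilityMeasure π] {s : ℝ≥0∞} (hs : s ≠ ∞)
    (hB0 : π (chiSqBall f s) ≠ 0)
    (hπ : ∀ᵐ θ ∂π, ∫⁻ x, ENNReal.ofReal (θ.density x) ∂lam ≤ 1) (n : ℕ) :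
    ∀ᵐ X ∂(sampleLaw f n), IsProbabilityMeasure (postDist π X) := by
  have := isProbabilityMeasure_sampleLaw hd n
  have htop : ∀ᵐ X ∂(sampleLaw f n), ∫⁻ θ, likRatio f θ X ∂π < ∞ := by
    refine ae_lt_top (measurable_lintegral_likRatio hf measurable_id π) (ne_top_of_le_ne_top
      ENNReal.one_ne_top ?_)
    have h := lintegral_likRatio_swap hf measurable_id (sampleLaw f n) π
    simp only [id] at h ⊢
    rw [h]
    calc _ ≤ ∫⁻ _, 1 ∂π := lintegral_mono_ae (hπ.mono fun θ hθ =>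
          lintegral_likRatio_le_one hf hd hθ n)
      _ = 1 := by rw [lintegral_one, measure_univ]
  have hzero : ∀ᵐ X ∂(sampleLaw f n), ∫⁻ θ, likRatio f θ X ∂π ≠ 0 := by
    rw [ae_iff]
    simp only [ne_eq, not_not]
    refine le_antisymm ?_ zero_le
    have hlim : Tendsto (fun c : ℕ => (c : ℝ≥0∞)⁻¹ * s ^ n) atTop (𝓝 0) := by
      have h := ENNReal.Tendsto.mul_const (b := s ^ n) ENNReal.tendsto_inv_nat_nhds_zero
        (Or.inr (ENNReal.pow_ne_top hs))
      rwa [zero_mul] at h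
    refine ge_of_tendsto hlim ?_
    filter_upwards [eventually_ge_atTop 1] with c hc
    refine le_trans (measure_mono fun X hX => ?_) (sampleLaw_evidence_lt_le hf hd π
      (measurableSet_chiSqBall hf s) (fun θ hθ => hθ) hB0 (c := c)
      (by exact_mod_cast Nat.one_le_iff_ne_zero.1 hc) (ENNReal.natCast_ne_top c) n)
    rw [mem_ofPred_eq] at hX ⊢
    rw [hX, mul_zero]
    exact pos_iff_ne_zero.2 hB0
  filter_upwards [htop, hzero, ae_sampleLaw_pos hf hd n] with X h1 h2 h3
  constructor
  rw [postDist_apply_eq hf π h3 MeasurableSet.univ, Measure.restrict_univ,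
    ENNReal.inv_mul_cancel h2 h1.ne]

theorem measurable_distL1 {f : ℝ → ℝ} (hf : Measurable f) :
    Measurable fun θ : Param => distL1 θ.density f := by
  simp_rw [distL1_eq_lintegral]
  have h : Measurable fun z : Param × ℝ => ENNReal.ofReal |z.1.density z.2 - f z.2| := by
    have := measurable_density
    fun_prop
  exact h.lintegral_prod_right'

theorem lintegral_density_eq_one {θ : Param} (hθ : θ.2 ∈ simplex θ.1) :
    ∫⁻ x, ENNReal.ofReal (θ.density x) ∂lam = 1 := by
  have h := lintegral_polygon θ.1 hθ.1
  rw [hθ.2, ENNReal.ofReal_one] at h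
  exact h

theorem distL1_le_two {f : ℝ → ℝ} (hd : IsDensity f) {θ : Param} (hθ : θ.2 ∈ simplex θ.1) :
    distL1 θ.density f ≤ 2 := by
  have hm := measurable_density_left θ
  rw [distL1_eq_lintegral, ← one_add_one_eq_two, ← hd.2]
  nth_rw 1 [hd.2]
  rw [← lintegral_density_eq_one hθ, ← lintegral_add_left (by fun_prop)]
  refine lintegral_mono_ae ?_
  filter_upwards [ae_lam_mem] with x hx
  have h0 : 0 ≤ θ.density x := polygon_nonneg hθ.1 hx
  rw [← ENNReal.ofReal_add h0 (hd.1 x hx)]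
  apply ENNReal.ofReal_le_ofReal
  rw [abs_le]
  constructor <;> linarith [hd.1 x hx]

/-- Convexity of the norm bounds the distance by the posterior mean of `distL1`. That mean is split
at `r`, using that two densities are at distance at most `2`. -/
theorem distL1_bayesEstimator_le {f : ℝ → ℝ} (hf : Measurable f) (hd : IsDensity f)
    {π : Measure Param} (hπ : ∀ᵐ θ ∂π, θ.2 ∈ simplex θ.1) {n : ℕ} {X : Fin n → ℝ}
    [IsProbabilityMeasure (postDist π X)] (r : ℝ≥0∞) :
    distL1 (bayesEstimator π X) f ≤ r + 2 * postDist π X {θ | r < distL1 θ.density f} := by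
  have hpost : ∀ᵐ θ ∂(postDist π X), θ.2 ∈ simplex θ.1 := by
    have h : postDist π X ≪ π :=
      (withDensity_absolutelyContinuous π _).smul_left _
    exact h.ae_le hπ
  have hm : Measurable fun z : ℝ × Param => z.2.density z.1 :=
    measurable_density_comp measurable_snd measurable_fst
  -- The Bochner integral defining the estimator is meaningful only where the density is integrable
  -- in `θ`; Tonelli gives this for almost every `x`.
  have hfin : ∀ᵐ x ∂lam, ∫⁻ θ, ENNReal.ofReal (θ.density x) ∂(postDist π X) < ∞ := by
    have hm1 : Measurable fun z : ℝ × Param => ENNReal.ofReal (z.2.density z.1) :=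
      hm.ennreal_ofReal
    refine ae_lt_top hm1.lintegral_prod_right' (ne_top_of_le_ne_top ENNReal.one_ne_top ?_)
    rw [lintegral_lintegral_swap (f := fun x θ => ENNReal.ofReal (Param.density θ x))
      hm1.aemeasurable]
    calc _ ≤ ∫⁻ _, 1 ∂(postDist π X) :=
          lintegral_mono_ae (hpost.mono fun θ hθ => (lintegral_density_eq_one hθ).le)
      _ = 1 := by rw [lintegral_one, measure_univ]
  have hpt : ∀ᵐ x ∂lam, ENNReal.ofReal |bayesEstimator π X x - f x|
      ≤ ∫⁻ θ, ENNReal.ofReal |θ.density x - f x| ∂(postDist π X) := by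
    filter_upwards [hfin, ae_lam_mem] with x hx hxI
    have hmx : Measurable fun θ : Param => θ.density x :=
      measurable_density_comp measurable_id measurable_const
    have hint : Integrable (fun θ : Param => θ.density x) (postDist π X) := by
      refine ⟨hmx.aestronglyMeasurable, ?_⟩
      rw [hasFiniteIntegral_iff_ofReal]
      · exact hx
      · filter_upwards [hpost] with θ hθ
        exact polygon_nonneg hθ.1 hxI
    have hsub : bayesEstimator π X x - f x = ∫ θ, (θ.density x - f x) ∂(postDist π X) := by
      rw [integral_sub hint (integrable_const _), integral_const, probReal_univ, one_smul]
      rfl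
    rw [hsub]
    simp only [← Real.enorm_eq_ofReal_abs]
    exact enorm_integral_le_lintegral_enorm _
  have hm2 : Measurable fun z : ℝ × Param => ENNReal.ofReal |z.2.density z.1 - f z.1| := by
    fun_prop
  have hS : MeasurableSet {θ : Param | r < distL1 θ.density f} :=
    measurableSet_lt measurable_const (measurable_distL1 hf)
  calc distL1 (bayesEstimator π X) f
      ≤ ∫⁻ x, ∫⁻ θ, ENNReal.ofReal |θ.density x - f x| ∂(postDist π X) ∂lam := by
        rw [distL1_eq_lintegral]
        exact lintegral_mono_ae hpt
    _ = ∫⁻ θ, distL1 θ.density f ∂(postDist π X) := by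
        rw [lintegral_lintegral_swap (f := fun x θ => ENNReal.ofReal |Param.density θ x - f x|)
          hm2.aemeasurable]
        simp_rw [distL1_eq_lintegral]
    _ ≤ ∫⁻ θ, (r + {θ : Param | r < distL1 θ.density f}.indicator (fun _ => 2) θ)
          ∂(postDist π X) := by
        refine lintegral_mono_ae ?_
        filter_upwards [hpost] with θ hθ
        by_cases h : r < distL1 θ.density f
        · rw [indicator_of_mem (show θ ∈ {θ : Param | r < distL1 θ.density f} from h)]
          exact (distL1_le_two hd hθ).trans le_add_self
        · exact (not_lt.1 h).trans le_self_add
    _ = _ := by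
        rw [lintegral_add_left measurable_const, lintegral_const, measure_univ, mul_one,
          lintegral_indicator_const hS]

theorem add_sq_le_two_mul (a b : ℝ≥0∞) : (a + b) ^ 2 ≤ 2 * a ^ 2 + 2 * b ^ 2 := by
  rcases eq_or_ne a ∞ with rfl | ha
  · simp
  rcases eq_or_ne b ∞ with rfl | hb
  · simp
  lift a to NNReal using ha
  lift b to NNReal using hb
  norm_cast
  rw [← NNReal.coe_le_coe]
  push_cast
  nlinarith [sq_nonneg ((a : ℝ) - b)]

/-- With `p` the posterior mass beyond `r`: `(r + 2p)² ≤ 2r² + 8p² ≤ 2r² + 8p`, as `p ≤ 1`. -/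
theorem lintegral_distL1_bayesEstimator_sq_le {f : ℝ → ℝ} (hf : Measurable f) (hd : IsDensity f)
    {π : Measure Param} (hπ : ∀ᵐ θ ∂π, θ.2 ∈ simplex θ.1) {n : ℕ}
    (hprob : ∀ᵐ X ∂(sampleLaw f n), IsProbabilityMeasure (postDist π X)) (r : ℝ≥0∞) :
    ∫⁻ X, distL1 (bayesEstimator π X) f ^ 2 ∂(sampleLaw f n)
      ≤ 2 * r ^ 2 + 8 * ∫⁻ X, postDist π X {θ | r < distL1 θ.density f} ∂(sampleLaw f n) := by
  have := isProbabilityMeasure_sampleLaw hd n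
  calc _ ≤ ∫⁻ X, (2 * r ^ 2 + 8 * postDist π X {θ | r < distL1 θ.density f})
          ∂(sampleLaw f n) := by
        refine lintegral_mono_ae ?_
        filter_upwards [hprob] with X hX
        have h1 : postDist π X {θ | r < distL1 θ.density f} ≤ 1 := prob_le_one
        calc _ ≤ (r + 2 * postDist π X {θ | r < distL1 θ.density f}) ^ 2 := by
              gcongr
              exact distL1_bayesEstimator_le hf hd hπ r
          _ ≤ _ := add_sq_le_two_mul _ _
          _ ≤ _ := by
              gcongr 2 * r ^ 2 + ?_
              rw [mul_pow, ← mul_assoc, show (2 : ℝ≥0∞) * 2 ^ 2 = 8 by norm_num]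
              gcongr
              exact pow_le_of_le_one zero_le h1 two_ne_zero
    _ = _ := by
        rw [lintegral_add_left measurable_const, lintegral_const, measure_univ, mul_one,
          lintegral_const_mul' _ _ (by norm_num)]

/-! ### Replacing `f₀` by a measurable function -/

theorem sampleLaw_congr {f g : ℝ → ℝ} (h : EqOn f g (Icc 0 1)) (n : ℕ) :
    sampleLaw f n = sampleLaw g n := by
  unfold sampleLaw
  have : (lam.withDensity fun x => ENNReal.ofReal (f x))
      = lam.withDensity fun x => ENNReal.ofReal (g x) := by
    refine withDensity_congr_ae ?_
    filter_upwards [ae_lam_mem] with x hx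
    rw [h hx]
  rw [this]

theorem distL1_congr {f g : ℝ → ℝ} (h : EqOn f g (Icc 0 1)) (p : ℝ → ℝ) :
    distL1 p f = distL1 p g := by
  rw [distL1_eq_lintegral, distL1_eq_lintegral]
  refine lintegral_congr_ae ?_
  filter_upwards [ae_lam_mem] with x hx
  rw [h hx]

theorem IsDensity.congr {f g : ℝ → ℝ} (h : EqOn f g (Icc 0 1)) (hf : IsDensity f) :
    IsDensity g := by
  refine ⟨fun x hx => by rw [← h hx]; exact hf.1 x hx, ?_⟩
  rw [← hf.2]
  refine lintegral_congr_ae ?_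
  filter_upwards [ae_lam_mem] with x hx
  rw [h hx]

end RandomPolygon

/-! ### Proof of the theorem -/

open RandomPolygon in
theorem theorem1
    -- the prior on the number of bins
    (ρ : PMF ℕ+) (B₁ B₂ β₁ β₂ : ℝ) (hB₁ : 0 < B₁) (hB₂ : 0 < B₂) (hβ₁ : 0 < β₁) (hβ₂ : 0 < β₂)
    (hρ : ∀ k : ℕ+, B₁ * Real.exp (-β₁ * (k : ℝ) * Real.log (k : ℝ)) ≤ (ρ k).toReal ∧
      (ρ k).toReal ≤ B₂ * Real.exp (-β₂ * (k : ℝ) * Real.log (k : ℝ)))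
    -- the base measure of the Dirichlet process
    (α : Measure ℝ) (a : ℝ → ℝ) (ha : ContinuousOn a (Icc 0 1)) (ha' : ∀ x ∈ Icc (0 : ℝ) 1, 0 < a x)
    (hα : α = lam.withDensity fun x => ENNReal.ofReal (a x)) :
    ∀ β : ℝ, 0 < β → β ≤ 2 → ∀ f₀ : ℝ → ℝ,
      IsDensity f₀ → HolderSmooth β f₀ → ∫⁻ x, (ENNReal.ofReal (f₀ x))⁻¹ ∂lam < ⊤ →
      (1 < β → BC1 β f₀ ∧ BC2 β f₀) →
      (∃ M₀ : ℝ, 0 < M₀ ∧ ∀ M : ℝ, M₀ ≤ M →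
        Tendsto (fun n : ℕ => ∫⁻ X, postDist (polygonPrior ρ α) X
            {θ | ENNReal.ofReal (M * rate β n) < distL1 θ.density f₀} ∂(sampleLaw f₀ n))
          atTop (𝓝 0)) ∧
      (∃ C : ℝ, 0 < C ∧ ∀ᶠ n : ℕ in atTop,
        ∫⁻ X, distL1 (bayesEstimator (polygonPrior ρ α) X) f₀ ^ 2 ∂(sampleLaw f₀ n)
          ≤ ENNReal.ofReal (C * rate β n ^ 2)) := by
  intro β hβ hβ2 f₀ hd₀ hH hJ₀ hBC
  obtain ⟨A, hA, happ₀⟩ := exists_polygon_approx hβ hβ2 hH hBC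
  have hcont₀ : ContinuousOn f₀ (Icc 0 1) := hH.1.continuousOn
  -- Nothing is known of `f₀` off `[0, 1]`, not even measurability. Its constant extension is
  -- continuous on `ℝ` and changes neither the sampling law nor any distance.
  set f : ℝ → ℝ := fun x => f₀ (projIcc 0 1 zero_le_one x) with hfdef
  have hfc : Continuous f :=
    hcont₀.comp_continuous (continuous_subtype_val.comp continuous_projIcc) fun x => Subtype.prop _
  have hEq : EqOn f₀ f (Icc 0 1) := fun x hx => by
    simp only [hfdef, projIcc_of_mem zero_le_one hx]
  have hd : IsDensity f := hd₀.congr hEq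
  have hJ : ∫⁻ x, (ENNReal.ofReal (f x))⁻¹ ∂lam < ⊤ := by
    refine lt_of_eq_of_lt (lintegral_congr_ae ?_) hJ₀
    filter_upwards [ae_lam_mem] with x hx
    rw [hEq hx]
  have happ : ∀ (k : ℕ+), ∀ x ∈ Icc (0 : ℝ) 1,
      |polygon k (fun j => f (mid k j) / k) x - f x| ≤ A * (k : ℝ) ^ (-β) := by
    intro k x hx
    have h := happ₀ k x hx
    rw [hEq hx] at h
    have e : (fun j : Fin k => f₀ (mid k j) / (k : ℝ)) = fun j : Fin k => f (mid k j) / (k : ℝ) :=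
      funext fun j => by rw [hEq (mid_mem_Icc k j)]
    rwa [e] at h
  obtain ⟨F, hF⟩ := isCompact_Icc.exists_bound_of_continuousOn (s := Icc (0 : ℝ) 1)
    hfc.continuousOn
  obtain ⟨c, C', hc, hbin⟩ := exists_bin_bounds ha ha'
  rw [← hα] at hbin
  have hpos : ∀ (k : ℕ+) (j : Fin k), 0 < (α (bin k j)).toReal := fun k j =>
    (div_pos hc (by exact_mod_cast k.pos)).trans_le (hbin k j).1
  obtain ⟨C₂, D, hC₂, hD, hdir⟩ := exists_dirichlet_chiSqBall_ge hfc.measurable hd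
    (fun x hx => (le_abs_self _).trans (hF x hx)) hA hβ happ hJ hc (C := C')
  have hdir' := fun k : ℕ+ => hdir k (fun j => (α (bin k j)).toReal) (hbin k)
  obtain ⟨M₀, C, hM₀, hC, hmain⟩ := exists_expected_posterior_le hB₁ hB₂ hβ₁ hβ₂ hρ hpos
    hfc.measurable hd hβ hC₂ hD hdir'
  simp only [sampleLaw_congr hEq, distL1_congr hEq]
  -- The risk constant is `2r² + 8p` with `r = M₀ ε` and expected far mass at most `C ε²`.
  refine ⟨⟨M₀, hM₀, fun M hM => ?_⟩, 2 * M₀ ^ 2 + 8 * C, by positivity, ?_⟩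
  · refine tendsto_of_tendsto_of_tendsto_of_le_of_le' tendsto_const_nhds ?_
      (Eventually.of_forall fun _ => zero_le) (hmain M hM)
    have h := ENNReal.tendsto_ofReal (((tendsto_rate hβ).pow 2).const_mul C)
    simpa using h
  · filter_upwards [hmain M₀ le_rfl, eventually_le_log 2] with n hn hlog
    have := isProbabilityMeasure_polygonPrior (ρ := ρ) hpos
    have hsim := ae_polygonPrior_mem_simplex (ρ := ρ) hpos
    have hpri := polygonPrior_chiSqBall_ge hfc.measurable hB₁ hβ₁ hC₂ hD hβ
      (fun k => (hρ k).1) hdir' hlog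
    have hrate := rate_pos hβ (show 1 ≤ Real.log n by linarith)
    have hprob := ae_isProbabilityMeasure_postDist hfc.measurable hd (polygonPrior ρ α)
      (s := 1 + ENNReal.ofReal (C₂ * rate β n ^ 2))
      (ENNReal.add_ne_top.2 ⟨ENNReal.one_ne_top, ENNReal.ofReal_ne_top⟩)
      ((ENNReal.ofReal_pos.2 (by positivity)).trans_le hpri).ne'
      (hsim.mono fun θ hθ => (lintegral_density_eq_one hθ).le) n
    refine (lintegral_distL1_bayesEstimator_sq_le hfc.measurable hd hsim hprob
      (ENNReal.ofReal (M₀ * rate β n))).trans ?_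
    refine (add_le_add_right (mul_le_mul_right hn _) _).trans (le_of_eq ?_)
    rw [← ENNReal.ofReal_pow (by positivity), ← ENNReal.ofReal_ofNat 2,
      ← ENNReal.ofReal_ofNat 8, ← ENNReal.ofReal_mul (by positivity),
      ← ENNReal.ofReal_mul (by positivity), ← ENNReal.ofReal_add (by positivity) (by positivity)]
    congr 1
    ring
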